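/- Let $z,a\in\mathbb C$ with $\operatorname{Im} z>0$, and let powers of $-z$ be taken with $\arg(-z)\in(-\pi,0)$. For a loop $C$ and a real number $M$ put $$I_C(M)=\int_C e^{-t}\,(-t)^{M+a}\,(z-t)^{-M}\,dt .$$ Here $C$ is one of the following two kinds of loops, which come from $+\infty$ along a horizontal line $\operatorname{Im}t=\eta$, go down along a vertical line $\operatorname{Re}t=-\delta$, and return to $+\infty$ along a horizontal line $\operatorname{Im}t=-\eta'$, with $\delta,\eta,\eta'>0$ fixed; so they go around $0$ counterclockwise. The loop $C=C'$ goes around both $0$ and $z$: $\eta>\operatorname{Im}z$ and $-\delta<\operatorname{Re}z$. The loop $C=C''$ goes around $0$ and leaves $z$ outside, above it: $\eta<\operatorname{Im}z$. (By Cauchy's theorem $I_{C'}$ and $I_{C''}$ depend only on the homotopy class of the loop.) The branch of the integrand is the one that is continuous along $C$ and has $\arg(-t)=0$ and $\arg(z-t)\in(0,\pi)$ at the point of $C$ where $t$ is negative. Then both integrals converge absolutely for every real $M$, and as $M\to+\infty$ through real values, with $z$ and $a$ fixed, $$I_{C'}(M)=-\,i\,\pi^{1/2}\,(-zM)^{(2a+1)/4}\,\exp\bigl(2(-zM)^{1/2}-z/2\bigr)\,\bigl(1+O(M^{-1/2})\bigr),$$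 $$I_{C''}(M)=\pi^{1/2}\,\bigl(e^{2\pi i(M+a)}-1\bigr)\,(-zM)^{(2a+1)/4}\,\exp\bigl(-2(-zM)^{1/2}-z/2-\pi i a-2\pi i M\bigr)\,\bigl(1+O(M^{-1/2})\bigr).$$ -/

import Mathlib

open Complex Filter Asymptotics MeasureTheory

noncomputable section

/-- A loop in the complex plane that starts at `+∞`, comes in along the horizontal line
`Im t = up`, goes down along the vertical line `Re t = -left`, and returns to `+∞` along the
horizontal line `Im t = -down`.  It passes around `0` once, counterclockwise, and it meets the
negative real axis in the single point `-left`. -/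
structure HankelLoop where
  left : ℝ
  up : ℝ
  down : ℝ
  left_pos : 0 < left
  up_pos : 0 < up
  down_pos : 0 < down

namespace HankelLoop

/-- The set of points of the loop. -/
def carrier (C : HankelLoop) : Set ℂ :=
  {t | (-C.left ≤ t.re ∧ (t.im = C.up ∨ t.im = -C.down)) ∨
    (t.re = -C.left ∧ -C.down ≤ t.im ∧ t.im ≤ C.up)}

/-- The loop also goes around `z` (contour `C'`, when `Im z > 0`): it passes to the left of `z`
and its incoming side lies above `z`. -/
def IsOuter (C : HankelLoop) (z : ℂ) : Prop :=
  -C.left < z.re ∧ z.im < C.up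

/-- The loop goes around `0` but not around `z` (contour `C''`, when `Im z > 0`): the whole loop
lies below `z`, so that `z` stays outside. -/
def IsInner (C : HankelLoop) (z : ℂ) : Prop :=
  C.up < z.im

/-- The contour integral `∫_C f(t) dt`: the incoming horizontal side, traversed from right to left,
the vertical side, traversed downwards, and the outgoing horizontal side, traversed from left
to right. -/
def integral (C : HankelLoop) (f : ℂ → ℂ) : ℂ :=
  -(∫ x in Set.Ioi (-C.left), f (x + C.up * I))
    - I * (∫ y in (-C.down)..C.up, f (-C.left + y * I))
    + ∫ x in Set.Ioi (-C.left), f (x - C.down * I)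

/-- Absolute convergence of the contour integral `∫_C f(t) dt`. -/
def Converges (C : HankelLoop) (f : ℂ → ℂ) : Prop :=
  IntegrableOn (fun x : ℝ => f (x + C.up * I)) (Set.Ioi (-C.left)) ∧
  IntervalIntegrable (fun y : ℝ => f (-C.left + y * I)) volume (-C.down) C.up ∧
  IntegrableOn (fun x : ℝ => f (x - C.down * I)) (Set.Ioi (-C.left))

end HankelLoop

/-- The integrand `e^{-t} (-t)^{M+a} (z-t)^{-M}`, with `w ^ s = exp (s log w)` for the principal
logarithm.  On the loops considered here this is the branch that varies continuously along the
loop and has, at the point where `t` is negative, `arg (-t) = 0` and `arg (z-t) ∈ (0, π)`: see the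
facts below. -/
def loopIntegrand (z a : ℂ) (M : ℝ) (t : ℂ) : ℂ :=
  exp (-t) * (-t) ^ ((M : ℂ) + a) * (z - t) ^ (-(M : ℂ))

/-- `arg (-t)` is continuous along the loop. -/
theorem HankelLoop.neg_mem_slitPlane (C : HankelLoop) {t : ℂ} (ht : t ∈ C.carrier) :
    -t ∈ slitPlane := by
  have h1 := C.left_pos
  have h2 := C.up_pos
  have h3 := C.down_pos
  rw [mem_slitPlane_iff, neg_re, neg_im]
  rcases ht with ⟨_, h | h⟩ | ⟨h, _⟩
  · right; rw [h]; linarith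
  · right; rw [h]; linarith
  · left; rw [h]; linarith

/-- `arg (z - t)` is continuous along a loop around `0` and `z`. -/
theorem HankelLoop.IsOuter.sub_mem_slitPlane {C : HankelLoop} {z : ℂ} (hz : 0 < z.im)
    (h : C.IsOuter z) {t : ℂ} (ht : t ∈ C.carrier) : z - t ∈ slitPlane := by
  have h3 := C.down_pos
  obtain ⟨ha, hb⟩ := h
  rw [mem_slitPlane_iff, sub_re, sub_im]
  rcases ht with ⟨_, h | h⟩ | ⟨h, _⟩
  · right; rw [h]; linarith
  · right; rw [h]; linarith
  · left; rw [h]; linarith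

/-- `arg (z - t)` is continuous along a loop around `0` that leaves `z` outside. -/
theorem HankelLoop.IsInner.sub_mem_slitPlane {C : HankelLoop} {z : ℂ}
    (h : C.IsInner z) {t : ℂ} (ht : t ∈ C.carrier) : z - t ∈ slitPlane := by
  have h2 := C.up_pos
  have h3 := C.down_pos
  unfold HankelLoop.IsInner at h
  rw [mem_slitPlane_iff, sub_im]
  right
  rcases ht with ⟨_, h | h⟩ | ⟨_, _, h⟩ <;> linarith

/-- The normalization of both arguments at the point of the loop where `t` is negative. -/
theorem HankelLoop.arg_normalization (C : HankelLoop) {z : ℂ} (hz : 0 < z.im) :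
    arg (-(-C.left : ℂ)) = 0 ∧ arg (z - (-C.left : ℂ)) ∈ Set.Ioo 0 Real.pi := by
  refine ⟨by rw [neg_neg]; exact arg_ofReal_of_nonneg C.left_pos.le, ?_⟩
  have him : 0 < (z - (-C.left : ℂ)).im := by simpa using hz
  refine ⟨lt_of_le_of_ne (arg_nonneg_iff.2 him.le) fun h => ?_,
    lt_of_le_of_ne (arg_le_pi _) fun h => ?_⟩
  · exact him.ne (arg_eq_zero_iff.1 h.symm).2.symm
  · exact him.ne' (arg_eq_pi_iff.1 h).2

end

noncomputable section

/-! This is the saddle point method in logarithmic coordinates. Put `w = -z`, `k = (-z)^(1/2)` and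
`s = √M k`, so that `s² = wM`, `Re s > 0` and `Im s < 0`. Up to constant factors and the choice of
branches, the integrand is `e^{-t} t^a (1 + w/t)^{-M}`. For `t` of size `√M` its exponent is about
`-t - wM/t`, with saddle points `t = ±s`. The substitution `t = σ e^v` with `σ = ±s` gives
`saddleKernel`, whose exponent near `v = 0` is `-2σ cosh v + (a+1)v + (w/2)e^{-2v} + O(M^{-1/2})`.
The saddle therefore has height `exp(-2σ + w/2)` and profile `exp(-σv²)`, with Gaussian integral
`(π/s)^{1/2}` along the appropriate axis. The first correction is linear in `v` and integrates to
zero, so the relative error is `O(1/|s|) = O(M^{-1/2})`. The local expansion is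
`exists_norm_saddleKernel_sub_le`, and `exists_norm_integral_sub_gaussian_le` integrates it.

The inner loop collapses onto the cut `[0, ∞)`; the two branches of `(-t)^{M+a}` produce the
oscillating factor. The ray is then rotated to the direction of `s`, where it passes through the
saddle `t = s` (`integral_eq_cpow_mul_integral_saddleKernel`).

The outer loop uses `σ = -s`. It may be replaced by the circle `|t| = |s|`, that is `v ∈ [-πi, πi]`,
together with two half-lines `Im v = ±π` whose contribution is `O(e^{-Re s})`, negligible against
`e^{2s}` (`HankelLoop.IsOuter.norm_integral_sub_le`). The saddle is now `t = -s`, and the Gaussian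
runs along the imaginary `v`-axis. -/

/-! ### Cauchy's theorem in half-strips and strips. -/

theorem integrableOn_horizontal_of_exp_decay {f : ℂ → ℂ} {x₀ y b C X : ℝ} (hb : 0 < b)
    (hc : ContinuousOn (fun x : ℝ => f (x + y * I)) (Set.Ici x₀))
    (hbd : ∀ x ≥ X, ‖f (x + y * I)‖ ≤ C * Real.exp (-b * x)) :
    IntegrableOn (fun x : ℝ => f (x + y * I)) (Set.Ioi x₀) := by
  have h := (hc.locallyIntegrableOn (μ := volume) measurableSet_Ici).integrableOn_of_isBigO_atTop
    (IsBigO.of_bound C (eventually_atTop.2 ⟨X, fun x hx => ?_⟩))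
    ⟨Set.Ioi b, Ioi_mem_atTop b, exp_neg_integrableOn_Ioi b hb⟩
  · exact h.mono_set Set.Ioi_subset_Ici_self
  · rw [Real.norm_of_nonneg (Real.exp_pos _).le]
    exact hbd x hx

theorem continuousOn_horizontal {f : ℂ → ℂ} {s t : Set ℝ} (hc : ContinuousOn f (s ×ℂ t)) {y : ℝ}
    (hy : y ∈ t) : ContinuousOn (fun x : ℝ => f (x + y * I)) s :=
  hc.comp (by fun_prop) fun x hx => by simpa [mem_reProdIm] using ⟨hx, hy⟩

theorem continuousOn_vertical {f : ℂ → ℂ} {s t : Set ℝ} (hc : ContinuousOn f (s ×ℂ t)) {x : ℝ}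
    (hx : x ∈ s) : ContinuousOn (fun y : ℝ => f (x + y * I)) t :=
  hc.comp (by fun_prop) fun y hy => by simpa [mem_reProdIm] using ⟨hx, hy⟩

/-- Cauchy's theorem on a half-strip, for a function that decays exponentially to the right. -/
theorem integral_boundary_halfStrip {f : ℂ → ℂ} {x₀ y₀ y₁ b C X : ℝ} (hy : y₀ ≤ y₁) (hb : 0 < b)
    (hc : ContinuousOn f (Set.Ici x₀ ×ℂ Set.Icc y₀ y₁))
    (hd : DifferentiableOn ℂ f (Set.Ioi x₀ ×ℂ Set.Ioo y₀ y₁))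
    (hbd : ∀ x ≥ X, ∀ y ∈ Set.Icc y₀ y₁, ‖f (x + y * I)‖ ≤ C * Real.exp (-b * x)) :
    (∫ x in Set.Ioi x₀, f (x + y₀ * I)) - (∫ x in Set.Ioi x₀, f (x + y₁ * I)) =
      I * ∫ y in y₀..y₁, f (x₀ + y * I) := by
  have hint : ∀ y ∈ Set.Icc y₀ y₁, Tendsto (fun A : ℝ => ∫ x in x₀..A, f (x + y * I)) atTop
      (nhds (∫ x in Set.Ioi x₀, f (x + y * I))) := fun y hy' =>
    intervalIntegral_tendsto_integral_Ioi _ (integrableOn_horizontal_of_exp_decay hb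
      (continuousOn_horizontal hc hy') fun x hx => hbd x hx y hy') tendsto_id
  have hright : Tendsto (fun A : ℝ => ∫ y in y₀..y₁, f (A + y * I)) atTop (nhds 0) := by
    have h0 : Tendsto (fun A : ℝ => C * Real.exp (-b * A) * |y₁ - y₀|) atTop (nhds 0) := by
      have : Tendsto (fun A : ℝ => Real.exp (-b * A)) atTop (nhds 0) :=
        Real.tendsto_exp_atBot.comp (tendsto_id.const_mul_atTop_of_neg (neg_neg_of_pos hb))
      simpa using (this.const_mul C).mul_const |y₁ - y₀|
    refine squeeze_zero_norm' (eventually_atTop.2 ⟨X, fun A hA => ?_⟩) h0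
    refine intervalIntegral.norm_integral_le_of_norm_le_const fun y hy' => hbd A hA y ?_
    rw [Set.uIoc_of_le hy] at hy'
    exact ⟨hy'.1.le, hy'.2⟩
  have hlim := (((hint y₀ ⟨le_rfl, hy⟩).sub (hint y₁ ⟨hy, le_rfl⟩)).add (hright.const_mul I)).sub
    (tendsto_const_nhds (x := I * ∫ y in y₀..y₁, f (x₀ + y * I)))
  have hzero : (fun A : ℝ => (∫ x in x₀..A, f (x + y₀ * I)) - (∫ x in x₀..A, f (x + y₁ * I)) +
      I * (∫ y in y₀..y₁, f (A + y * I)) - I * ∫ y in y₀..y₁, f (x₀ + y * I)) =ᶠ[atTop]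
      fun _ => 0 := by
    filter_upwards [eventually_ge_atTop x₀] with A hA
    have := integral_boundary_rect_eq_zero_of_continuousOn_of_differentiableOn f
      (x₀ + y₀ * I) (A + y₁ * I) ?_ ?_
    · simpa using this
    · refine hc.mono ?_
      simp only [add_re, ofReal_re, mul_re, I_re, mul_zero, ofReal_im, I_im, mul_one, sub_self,
        add_zero, add_im, mul_im, zero_add, Set.uIcc_of_le hA, Set.uIcc_of_le hy]
      exact reProdIm_subset_iff.2 (Set.prod_mono Set.Icc_subset_Ici_self subset_rfl)
    · refine hd.mono ?_
      simp only [add_re, ofReal_re, mul_re, I_re, mul_zero, ofReal_im, I_im, mul_one, sub_self,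
        add_zero, add_im, mul_im, zero_add, min_eq_left hA, max_eq_right hA, min_eq_left hy,
        max_eq_right hy]
      exact reProdIm_subset_iff.2 (Set.prod_mono Set.Ioo_subset_Ioi_self subset_rfl)
  have := tendsto_nhds_unique (hlim.congr' hzero) tendsto_const_nhds
  simpa [sub_eq_zero] using this

/-- Shift of the line of integration inside a strip. -/
theorem integral_horizontal_eq_of_exp_decay {f : ℂ → ℂ} {y₀ y₁ b C : ℝ} (hy : y₀ ≤ y₁)
    (hb : 0 < b) (hd : DifferentiableOn ℂ f (Set.univ ×ℂ Set.Icc y₀ y₁))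
    (hbd : ∀ x : ℝ, ∀ y ∈ Set.Icc y₀ y₁, ‖f (x + y * I)‖ ≤ C * Real.exp (-b * |x|)) :
    ∫ x : ℝ, f (x + y₀ * I) = ∫ x : ℝ, f (x + y₁ * I) := by
  -- The reflection `v ↦ -v` reduces the left half of the strip to a right half-strip; the two
  -- integrals over the segment `Re v = 0` then cancel.
  have hdn : DifferentiableOn ℂ (fun v => f (-v)) (Set.univ ×ℂ Set.Icc (-y₁) (-y₀)) := by
    refine hd.comp (by fun_prop) fun v hv => ?_
    simp only [mem_reProdIm, Set.mem_univ, Set.mem_Icc, true_and, neg_im] at hv ⊢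
    constructor <;> linarith [hv.1, hv.2]
  have hbdn : ∀ x : ℝ, ∀ y ∈ Set.Icc (-y₁) (-y₀),
      ‖f (-(x + y * I))‖ ≤ C * Real.exp (-b * |x|) := fun x y hy' => by
    have := hbd (-x) (-y) ⟨by linarith [hy'.2], by linarith [hy'.1]⟩
    rw [abs_neg] at this
    convert! this using 3
    push_cast; ring
  have hsub : ∀ u v : ℝ, Set.Ici (0 : ℝ) ×ℂ Set.Icc u v ⊆ Set.univ ×ℂ Set.Icc u v := fun u v =>
    reProdIm_subset_iff.2 (Set.prod_mono (Set.subset_univ _) subset_rfl)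
  have hsub' : ∀ u v : ℝ, Set.Ioi (0 : ℝ) ×ℂ Set.Ioo u v ⊆ Set.univ ×ℂ Set.Icc u v := fun u v =>
    reProdIm_subset_iff.2 (Set.prod_mono (Set.subset_univ _) Set.Ioo_subset_Icc_self)
  have hbd1 : ∀ x ≥ (0 : ℝ), ∀ y ∈ Set.Icc y₀ y₁, ‖f (x + y * I)‖ ≤ C * Real.exp (-b * x) :=
    fun x hx y hy' => by simpa [abs_of_nonneg hx] using hbd x y hy'
  have hbd2 : ∀ x ≥ (0 : ℝ), ∀ y ∈ Set.Icc (-y₁) (-y₀),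
      ‖f (-(x + y * I))‖ ≤ C * Real.exp (-b * x) :=
    fun x hx y hy' => by simpa [abs_of_nonneg hx] using hbdn x y hy'
  have h1 := integral_boundary_halfStrip hy hb (hd.continuousOn.mono (hsub _ _))
    (hd.mono (hsub' _ _)) hbd1
  have h2 := integral_boundary_halfStrip (neg_le_neg hy) hb (hdn.continuousOn.mono (hsub _ _))
    (hdn.mono (hsub' _ _)) hbd2
  have key : ∀ y ∈ Set.Icc y₀ y₁, ∫ x : ℝ, f (x + y * I) =
      (∫ x in Set.Ioi (0 : ℝ), f (-(x + ((-y : ℝ) : ℂ) * I))) +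
        ∫ x in Set.Ioi (0 : ℝ), f (x + y * I) := by
    intro y hy'
    have e : ∀ x : ℝ, f (-(x + ((-y : ℝ) : ℂ) * I)) = f ((-x : ℝ) + y * I) := fun x => by
      congr 1; push_cast; ring
    have i1 : IntegrableOn (fun x : ℝ => f (x + y * I)) (Set.Ioi 0) :=
      integrableOn_horizontal_of_exp_decay hb
        (continuousOn_horizontal (hd.continuousOn.mono (hsub _ _)) hy') fun x hx => hbd1 x hx y hy'
    have i2 : IntegrableOn (fun x : ℝ => f (-(x + ((-y : ℝ) : ℂ) * I))) (Set.Ioi 0) :=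
      integrableOn_horizontal_of_exp_decay (f := fun v => f (-v)) hb
        (continuousOn_horizontal (hdn.continuousOn.mono (hsub _ _))
          ⟨neg_le_neg hy'.2, neg_le_neg hy'.1⟩)
        fun x hx => hbd2 x hx (-y) ⟨neg_le_neg hy'.2, neg_le_neg hy'.1⟩
    simp only [e] at i2 ⊢
    rw [integral_comp_neg_Ioi 0 (fun x : ℝ => f (x + y * I)), neg_zero]
    have i3 : IntegrableOn (fun x : ℝ => f (x + y * I)) (Set.Iic 0) := by
      have := (Measure.measurePreserving_neg (volume : Measure ℝ)).integrableOn_comp_preimage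
        (Homeomorph.neg ℝ).measurableEmbedding (f := fun x : ℝ => f (x + y * I)) (s := Set.Iio 0)
      rw [integrableOn_Iic_iff_integrableOn_Iio]
      refine this.1 ?_
      simpa [Function.comp_def] using i2
    exact (intervalIntegral.integral_Iic_add_Ioi i3 i1).symm
  rw [key y₀ ⟨le_rfl, hy⟩, key y₁ ⟨hy, le_rfl⟩]
  have hv : ∫ y in (-y₁)..(-y₀), f (-(((0 : ℝ) : ℂ) + y * I)) =
      ∫ y in y₀..y₁, f (((0 : ℝ) : ℂ) + y * I) := by
    rw [← intervalIntegral.integral_comp_neg]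
    refine intervalIntegral.integral_congr fun y _ => ?_
    simp
  rw [hv] at h2
  linear_combination h1 - h2

/-! ### Decay of the integrand and absolute convergence. -/

/-- A power is dominated by an exponential away from the origin. -/
theorem exists_norm_cpow_le_exp (p : ℂ) {δ η : ℝ} (hδ : 0 < δ) (hη : 0 < η) :
    ∃ C, 0 ≤ C ∧ ∀ u : ℂ, δ ≤ ‖u‖ → ‖u ^ p‖ ≤ C * Real.exp (η * ‖u‖) := by
  have hO : (fun x : ℝ => x ^ p.re) =O[atTop] fun x => Real.exp (η * x) :=
    (isLittleO_rpow_exp_pos_mul_atTop p.re hη).isBigO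
  obtain ⟨C₁, hC₁⟩ := hO.bound
  obtain ⟨N, hN⟩ := eventually_atTop.1 hC₁
  have hcont : ContinuousOn (fun x : ℝ => x ^ p.re) (Set.Icc δ (max δ N)) :=
    continuousOn_id.rpow_const fun x hx => Or.inl (hδ.trans_le hx.1).ne'
  obtain ⟨C₂, hC₂⟩ := isCompact_Icc.exists_bound_of_continuousOn hcont
  have hreal : ∀ x, δ ≤ x → x ^ p.re ≤ max |C₁| |C₂| * Real.exp (η * x) := by
    intro x hx
    have hx0 := hδ.trans_le hx
    have h1 : 1 ≤ Real.exp (η * x) := Real.one_le_exp (by positivity)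
    rcases le_total N x with h | h
    · have := hN x h
      rw [Real.norm_of_nonneg (by positivity), Real.norm_of_nonneg (by positivity)] at this
      refine this.trans ?_
      gcongr
      exact (le_abs_self _).trans (le_max_left _ _)
    · have := hC₂ x ⟨hx, h.trans (le_max_right _ _)⟩
      rw [Real.norm_of_nonneg (by positivity)] at this
      calc x ^ p.re ≤ |C₂| := this.trans (le_abs_self _)
        _ ≤ max |C₁| |C₂| * 1 := by rw [mul_one]; exact le_max_right _ _
        _ ≤ _ := by gcongr
  refine ⟨max |C₁| |C₂| * Real.exp (Real.pi * |p.im|), by positivity, fun u hu => ?_⟩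
  have hu0 : u ≠ 0 := norm_pos_iff.1 (hδ.trans_le hu)
  rw [norm_cpow_of_ne_zero hu0, div_eq_mul_inv, ← Real.exp_neg]
  calc ‖u‖ ^ p.re * Real.exp (-(arg u * p.im))
      ≤ (max |C₁| |C₂| * Real.exp (η * ‖u‖)) * Real.exp (Real.pi * |p.im|) := by
        gcongr
        · exact hreal _ hu
        · calc -(arg u * p.im) ≤ |arg u * p.im| := neg_le_abs _
            _ = |arg u| * |p.im| := abs_mul _ _
            _ ≤ Real.pi * |p.im| := by gcongr; exact abs_arg_le_pi u
    _ = _ := by ring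

/-- Each power costs a rate `1/4`, which leaves `1/2` of the rate of `e^{-t}`. Only the modulus of
`u` is prescribed, so the bound serves `(-t)^p` as well as `t^p`. -/
theorem exists_norm_exp_mul_cpow_mul_cpow_le (z p q : ℂ) (Y : ℝ) :
    ∃ C, ∀ t u : ℂ, ‖u‖ = ‖t‖ → ‖z‖ + 1 ≤ t.re → |t.im| ≤ Y →
      ‖exp (-t) * u ^ p * (z - t) ^ q‖ ≤ C * Real.exp (-(1 / 2) * t.re) := by
  obtain ⟨C₁, hC₁, h₁⟩ := exists_norm_cpow_le_exp p one_pos (show (0 : ℝ) < 1 / 4 by norm_num)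
  obtain ⟨C₂, hC₂, h₂⟩ := exists_norm_cpow_le_exp q one_pos (show (0 : ℝ) < 1 / 4 by norm_num)
  refine ⟨C₁ * C₂ * Real.exp (Y / 2 + ‖z‖ / 4), fun t u hu hre him => ?_⟩
  have hz := norm_nonneg z
  have ht0 : 0 ≤ t.re := by linarith
  have htre : t.re ≤ ‖t‖ := re_le_norm t
  have hzt : ‖t‖ - ‖z‖ ≤ ‖z - t‖ := by rw [norm_sub_rev]; exact norm_sub_norm_le t z
  have hzt' : ‖z - t‖ ≤ ‖z‖ + ‖t‖ := norm_sub_le z t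
  have hnt : ‖t‖ ≤ t.re + Y := by
    refine (norm_le_abs_re_add_abs_im t).trans ?_
    rw [abs_of_nonneg ht0]; linarith
  have b₁ := h₁ u (by rw [hu]; linarith)
  have b₂ := h₂ (z - t) (by linarith)
  rw [norm_mul, norm_mul, norm_exp, neg_re]
  calc Real.exp (-t.re) * ‖u ^ p‖ * ‖(z - t) ^ q‖
      ≤ Real.exp (-t.re) * (C₁ * Real.exp (1 / 4 * ‖u‖)) *
          (C₂ * Real.exp (1 / 4 * ‖z - t‖)) := by gcongr
    _ = C₁ * C₂ * Real.exp (-t.re + 1 / 4 * ‖u‖ + 1 / 4 * ‖z - t‖) := by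
        rw [Real.exp_add, Real.exp_add]; ring
    _ ≤ C₁ * C₂ * Real.exp (Y / 2 + ‖z‖ / 4 + -(1 / 2) * t.re) := by
        refine mul_le_mul_of_nonneg_left (Real.exp_le_exp.2 ?_) (by positivity)
        rw [hu]; linarith
    _ = _ := by rw [Real.exp_add]; ring

theorem exists_norm_loopIntegrand_le (z a : ℂ) (M Y : ℝ) :
    ∃ C, ∀ x ≥ ‖z‖ + 1, ∀ y : ℝ, |y| ≤ Y →
      ‖loopIntegrand z a M (x + y * I)‖ ≤ C * Real.exp (-(1 / 2) * x) := by
  obtain ⟨C, hC⟩ := exists_norm_exp_mul_cpow_mul_cpow_le z (M + a) (-(M : ℂ)) Y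
  refine ⟨C, fun x hx y hy => ?_⟩
  simpa [loopIntegrand] using
    hC (x + y * I) (-(x + y * I)) (norm_neg _) (by simpa using hx) (by simpa using hy)

theorem differentiableAt_loopIntegrand {z a : ℂ} {M : ℝ} {t : ℂ} (h₁ : -t ∈ slitPlane)
    (h₂ : z - t ∈ slitPlane) : DifferentiableAt ℂ (loopIntegrand z a M) t := by
  unfold loopIntegrand
  refine DifferentiableAt.mul (DifferentiableAt.mul (by fun_prop) ?_) ?_
  · exact DifferentiableAt.cpow_const (by fun_prop) h₁
  · exact DifferentiableAt.cpow_const (by fun_prop) h₂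

theorem HankelLoop.converges_loopIntegrand (C : HankelLoop) {z : ℂ} (a : ℂ) (M : ℝ)
    (h : ∀ t ∈ C.carrier, z - t ∈ slitPlane) : C.Converges (loopIntegrand z a M) := by
  have hc : ContinuousOn (loopIntegrand z a M) C.carrier := fun t ht =>
    (differentiableAt_loopIntegrand (C.neg_mem_slitPlane ht)
      (h t ht)).continuousAt.continuousWithinAt
  have hu := C.up_pos
  have hd := C.down_pos
  have hline : ∀ y : ℝ, (y = C.up ∨ y = -C.down) →
      IntegrableOn (fun x : ℝ => loopIntegrand z a M (x + y * I)) (Set.Ioi (-C.left)) := by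
    intro y hy
    obtain ⟨B, hB⟩ := exists_norm_loopIntegrand_le z a M |y|
    refine integrableOn_horizontal_of_exp_decay (by norm_num) ?_ fun x hx => hB x hx y le_rfl
    exact hc.comp (by fun_prop) fun x hx => Or.inl ⟨by simpa using hx, by simpa using hy⟩
  refine ⟨hline _ (Or.inl rfl), ?_, ?_⟩
  · refine ContinuousOn.intervalIntegrable (hc.comp (by fun_prop) fun y hy => ?_)
    rw [Set.uIcc_of_le (by linarith)] at hy
    exact Or.inr ⟨by simp, by simpa using hy.1, by simpa using hy.2⟩
  · simpa [sub_eq_add_neg] using hline _ (Or.inr rfl)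

/-! ### Collapse of the inner loop onto the positive axis. -/

/-- The principal argument is continuous from above along the negative axis, and `Re p > 0` takes
care of the origin. This gives continuity up to the cut on the closed half-strips. -/
theorem continuousOn_cpow_im_nonneg {p : ℂ} (hp : 0 < p.re) :
    ContinuousOn (fun u : ℂ => u ^ p) {u | 0 ≤ u.im} := by
  intro u hu
  rcases eq_or_ne u 0 with rfl | h0
  · exact (continuousAt_cpow_const_of_re_pos (Or.inl le_rfl) hp).continuousWithinAt
  by_cases hs : u ∈ slitPlane
  · exact (continuousAt_cpow_const hs).continuousWithinAt
  · rw [mem_slitPlane_iff, not_or, not_lt, not_not] at hs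
    have hre : u.re < 0 := lt_of_le_of_ne hs.1 fun h => h0 (Complex.ext h hs.2)
    have hlog := continuousWithinAt_log_of_re_neg_of_im_zero hre hs.2
    refine ((hlog.mul_const p).cexp).congr_of_eventuallyEq ?_ (cpow_def_of_ne_zero h0 _)
    filter_upwards [nhdsWithin_le_nhds (isOpen_ne.mem_nhds h0)] with v hv
    exact cpow_def_of_ne_zero hv _

theorem log_neg_of_im_pos {u : ℂ} (hu : 0 < u.im) : log (-u) = log u - Real.pi * I := by
  rw [log, log, norm_neg, arg_neg_eq_arg_sub_pi_of_im_pos hu]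
  push_cast; ring

theorem neg_cpow_of_im_pos {u : ℂ} (hu : 0 < u.im) (p : ℂ) :
    (-u) ^ p = exp (-(Real.pi * I * p)) * u ^ p := by
  have h0 : u ≠ 0 := fun h => by simp [h] at hu
  rw [cpow_def_of_ne_zero h0, cpow_def_of_ne_zero (neg_ne_zero.2 h0), log_neg_of_im_pos hu,
    ← exp_add]
  congr 1; ring

/-- A loop that leaves `z` outside is collapsed onto the positive real axis. -/
theorem HankelLoop.IsInner.integral_loopIntegrand {C : HankelLoop} {z a : ℂ} {M : ℝ}
    (hC : C.IsInner z) (hp : 0 < ((M : ℂ) + a).re) :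
    C.integral (loopIntegrand z a M) =
      (exp (Real.pi * I * (M + a)) - exp (-(Real.pi * I * (M + a)))) *
        ∫ x in Set.Ioi (0 : ℝ), exp (-x) * (x : ℂ) ^ ((M : ℂ) + a) * (z - x) ^ (-(M : ℂ)) := by
  have hup := C.up_pos
  have hdn := C.down_pos
  have hl := C.left_pos
  have hCz : C.up < z.im := hC
  set p : ℂ := M + a with hpdef
  -- On the positive axis the integrand is continuous only from below. `fp` is its upper branch: it
  -- equals the integrand for `Im t > 0` and extends continuously down to the real axis.
  set fp : ℂ → ℂ := fun t => exp (-t) * (exp (-(Real.pi * I * p)) * t ^ p) * (z - t) ^ (-(M : ℂ))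
    with hfp
  have hzslit : ∀ t : ℂ, t.im ≤ C.up → z - t ∈ slitPlane := fun t ht => by
    rw [mem_slitPlane_iff, sub_im]; right; linarith
  have hczt : ∀ s : Set ℂ, (∀ t ∈ s, t.im ≤ C.up) →
      ContinuousOn (fun t : ℂ => (z - t) ^ (-(M : ℂ))) s := fun s hs t ht =>
    (DifferentiableAt.cpow_const (by fun_prop)
      (hzslit t (hs t ht))).continuousAt.continuousWithinAt
  obtain ⟨B₁, hB₁⟩ := exists_norm_exp_mul_cpow_mul_cpow_le z p (-(M : ℂ)) C.up
  obtain ⟨B₂, hB₂⟩ := exists_norm_loopIntegrand_le z a M C.down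
  have hfpc : ContinuousOn fp (Set.Ici (-C.left) ×ℂ Set.Icc 0 C.up) := by
    refine ContinuousOn.mul (ContinuousOn.mul (by fun_prop) (continuousOn_const.mul ?_)) (hczt _ ?_)
    · exact (continuousOn_cpow_im_nonneg hp).mono fun t ht => ht.2.1
    · exact fun t ht => ht.2.2
  have hfmc : ContinuousOn (loopIntegrand z a M) (Set.Ici (-C.left) ×ℂ Set.Icc (-C.down) 0) := by
    refine ContinuousOn.mul (ContinuousOn.mul (by fun_prop) ?_) (hczt _ ?_)
    · refine (continuousOn_cpow_im_nonneg hp).comp (by fun_prop) fun t ht => ?_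
      simpa using ht.2.2
    · exact fun t ht => ht.2.2.trans hup.le
  have hbp : ∀ x ≥ ‖z‖ + 1, ∀ y ∈ Set.Icc 0 C.up, ‖fp (x + y * I)‖ ≤
      (‖exp (-(Real.pi * I * p))‖ * B₁) * Real.exp (-(1 / 2) * x) := fun x hx y hy => by
    have := hB₁ (x + y * I) (x + y * I) rfl (by simpa using hx)
      (by simpa [abs_of_nonneg hy.1] using hy.2)
    have e : fp (x + y * I) = exp (-(Real.pi * I * p)) *
        (exp (-(x + y * I)) * (x + y * I) ^ p * (z - (x + y * I)) ^ (-(M : ℂ))) := by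
      simp only [hfp]; ring
    rw [e, norm_mul]
    exact (mul_le_mul_of_nonneg_left this (norm_nonneg _)).trans_eq (by simp [mul_assoc])
  have hbm : ∀ x ≥ ‖z‖ + 1, ∀ y ∈ Set.Icc (-C.down) 0, ‖loopIntegrand z a M (x + y * I)‖ ≤
      B₂ * Real.exp (-(1 / 2) * x) := fun x hx y hy =>
    hB₂ x hx y (by rw [abs_of_nonpos hy.2]; linarith [hy.1])
  have H₁ := integral_boundary_halfStrip hup.le (by norm_num) hfpc (fun t ht => by
      refine (DifferentiableAt.mul (DifferentiableAt.mul (by fun_prop)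
        ((differentiableAt_const _).mul (DifferentiableAt.cpow_const (by fun_prop) ?_)))
        (DifferentiableAt.cpow_const (by fun_prop)
        (hzslit t ht.2.2.le))).differentiableWithinAt
      exact mem_slitPlane_iff.2 (Or.inr ht.2.1.ne')) hbp
  have H₂ := integral_boundary_halfStrip (neg_nonpos.2 hdn.le) (by norm_num) hfmc (fun t ht =>
      (differentiableAt_loopIntegrand (mem_slitPlane_iff.2 (Or.inr
        (by simpa using ht.2.2.ne))) (hzslit t (ht.2.2.le.trans hup.le))).differentiableWithinAt)
      hbm
  have i₁ := integrableOn_horizontal_of_exp_decay (by norm_num)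
    (continuousOn_horizontal hfpc ⟨le_rfl, hup.le⟩) fun x hx => hbp x hx 0 ⟨le_rfl, hup.le⟩
  have i₂ := integrableOn_horizontal_of_exp_decay (by norm_num)
    (continuousOn_horizontal hfmc ⟨neg_nonpos.2 hdn.le, le_rfl⟩)
    fun x hx => hbm x hx 0 ⟨neg_nonpos.2 hdn.le, le_rfl⟩
  have hpos : ∀ t : ℂ, 0 < t.im → fp t = loopIntegrand z a M t := fun t ht => by
    simp only [hfp, loopIntegrand]
    rw [neg_cpow_of_im_pos ht]
  have hneg : ∀ t : ℂ, 0 < t.re → t.im = 0 →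
      loopIntegrand z a M t = exp (Real.pi * I * p) *
        (exp (-t) * t ^ p * (z - t) ^ (-(M : ℂ))) := fun t ht ht' => by
    obtain ⟨x, rfl⟩ : ∃ x : ℝ, t = x := ⟨t.re, Complex.ext (by simp) (by simpa using ht')⟩
    have := ofReal_cpow_of_nonpos (x := -x) (by simpa using ht.le) p
    push_cast at this
    rw [neg_neg] at this
    simp only [loopIntegrand]
    rw [← hpdef, this]; ring
  have hnp : ∀ x : ℝ, x ≤ 0 → fp x = loopIntegrand z a M x := fun x hx => by
    simp only [hfp, loopIntegrand]
    rw [ofReal_cpow_of_nonpos hx p, ← hpdef]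
    have : exp (-(Real.pi * I * p)) * ((-(x : ℂ)) ^ p * exp (Real.pi * I * p)) =
        (-(x : ℂ)) ^ p := by
      rw [mul_comm ((-(x : ℂ)) ^ p), ← mul_assoc, ← exp_add]; simp
    rw [this]
  have htop : ∫ x in Set.Ioi (-C.left), fp (x + C.up * I) =
      ∫ x in Set.Ioi (-C.left), loopIntegrand z a M (x + C.up * I) :=
    integral_congr_ae (Eventually.of_forall fun x => hpos _ (by simpa using hup))
  have hvert : ∫ y in (0 : ℝ)..C.up, fp ((-C.left : ℝ) + y * I) =
      ∫ y in (0 : ℝ)..C.up, loopIntegrand z a M ((-C.left : ℝ) + y * I) := by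
    refine intervalIntegral.integral_congr fun y hy => ?_
    rw [Set.uIcc_of_le hup.le] at hy
    rcases hy.1.eq_or_lt with h | h
    · simpa [← h] using hnp (-C.left) (by linarith)
    · exact hpos _ (by simpa using h)
  have hsplit : (∫ y in (-C.down)..C.up, loopIntegrand z a M (-C.left + y * I)) =
      (∫ y in (-C.down)..0, loopIntegrand z a M ((-C.left : ℝ) + y * I)) +
      ∫ y in (0 : ℝ)..C.up, loopIntegrand z a M ((-C.left : ℝ) + y * I) := by
    rw [intervalIntegral.integral_add_adjacent_intervals]
    · simp
    · exact ((continuousOn_vertical hfmc Set.self_mem_Ici).mono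
        (by rw [Set.uIcc_of_le (by linarith)])).intervalIntegrable
    · refine ((continuousOn_vertical hfpc Set.self_mem_Ici).congr fun y hy => ?_).mono
        (by rw [Set.uIcc_of_le hup.le]) |>.intervalIntegrable
      rcases hy.1.eq_or_lt with h | h
      · simpa [← h] using (hnp (-C.left) (by linarith)).symm
      · exact (hpos _ (by simpa using h)).symm
  rw [htop, hvert] at H₁
  simp only [ofReal_zero, zero_mul, add_zero] at H₁ H₂ i₁ i₂
  have hbot : ∫ x in Set.Ioi (-C.left), loopIntegrand z a M (x - C.down * I) =
      ∫ x in Set.Ioi (-C.left), loopIntegrand z a M (x + ((-C.down : ℝ) : ℂ) * I) := by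
    simp [sub_eq_add_neg]
  have hmain : C.integral (loopIntegrand z a M) =
      ∫ x in Set.Ioi (-C.left), (loopIntegrand z a M x - fp x) := by
    rw [integral_sub i₂ i₁, HankelLoop.integral, hsplit, hbot]
    linear_combination H₁ + H₂
  -- The two branches agree on the negative axis, so only the positive axis contributes.
  have hsub : ∫ x in Set.Ioi (-C.left), (loopIntegrand z a M x - fp x) =
      ∫ x in Set.Ioi (0 : ℝ), (loopIntegrand z a M x - fp x) := by
    refine (setIntegral_eq_of_subset_of_forall_sdiff_eq_zero measurableSet_Ioi
      (Set.Ioi_subset_Ioi (by linarith)) fun x hx => ?_)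
    rw [hnp x (not_lt.1 hx.2), sub_self]
  rw [hmain, hsub, ← integral_const_mul]
  refine setIntegral_congr_fun measurableSet_Ioi fun x hx => ?_
  rw [hneg x (by simpa using hx) (by simp)]
  simp only [hfp]
  ring

/-! ### Laplace's method. -/

theorem integrable_pow_mul_exp_neg_mul_sq {b : ℝ} (hb : 0 < b) (n : ℕ) :
    Integrable fun x : ℝ => x ^ n * Real.exp (-b * x ^ 2) := by
  simpa using integrable_rpow_mul_exp_neg_mul_sq hb (s := n) (by
    have : (0 : ℝ) ≤ n := n.cast_nonneg
    linarith)

/-- The linear term is odd and drops out. Keeping it in the model is what improves the relative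
error from `|s|^{-1/2}` to `|s|^{-1}`. -/
theorem integral_one_add_mul_cexp_neg_mul_sq {s : ℂ} (hs : 0 < s.re) (c : ℂ) :
    Integrable (fun x : ℝ => (1 + c * x) * exp (-s * x ^ 2)) ∧
      ∫ x : ℝ, (1 + c * x) * exp (-s * x ^ 2) = (Real.pi / s) ^ (1 / 2 : ℂ) := by
  have h₁ := integrable_cexp_neg_mul_sq hs
  have h₂ := (integrable_mul_cexp_neg_mul_sq hs).const_mul c
  have e : (fun x : ℝ => (1 + c * x) * exp (-s * x ^ 2)) =
      fun x : ℝ => exp (-s * x ^ 2) + c * (x * exp (-s * x ^ 2)) := by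
    funext x; ring
  rw [e]
  refine ⟨h₁.add h₂, ?_⟩
  rw [integral_add h₁ h₂, integral_gaussian_complex hs, integral_const_mul]
  have hodd : ∫ x : ℝ, (x : ℂ) * exp (-s * x ^ 2) = 0 := by
    have := integral_neg_eq_self (fun x : ℝ => (x : ℂ) * exp (-s * x ^ 2)) volume
    simp only [ofReal_neg, neg_sq, neg_mul, integral_neg] at this ⊢
    linear_combination (-1 / 2 : ℂ) * this
  rw [hodd, mul_zero, add_zero]

theorem exp_neg_le_div_pow_four {u : ℝ} (hu : 0 < u) : Real.exp (-u) ≤ 24 / u ^ 4 := by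
  have := Real.pow_div_factorial_le_exp u hu.le 4
  rw [Real.exp_neg, ← inv_div]
  refine inv_anti₀ (by positivity) ?_
  simpa [Nat.factorial] using this

/-- Laplace's method: a function close to `(1 + c x) exp (-s x²)` near the origin, and
exponentially small elsewhere, has integral close to that of the Gaussian. -/
theorem exists_norm_integral_sub_gaussian_le {κ R C : ℝ} (c : ℂ) (hκ : 0 < κ) (hR : 0 < R)
    (hC : 0 ≤ C) :
    ∃ C', ∀ s : ℂ, 1 ≤ ‖s‖ → κ * ‖s‖ ≤ s.re → ∀ F : ℝ → ℂ, AEStronglyMeasurable F →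
      (∀ x, |x| ≤ R → ‖F x - (1 + c * x) * exp (-s * x ^ 2)‖ ≤
        C * (‖s‖ * x ^ 4 + x ^ 2 + ‖s‖⁻¹) * Real.exp (-κ * ‖s‖ * x ^ 2)) →
      (∀ x, R < |x| → ‖F x‖ ≤ C * Real.exp (-κ * ‖s‖ * |x|)) →
      ‖(∫ x, F x) - (Real.pi / s) ^ (1 / 2 : ℂ)‖ ≤ C' * (‖s‖⁻¹ * (√‖s‖)⁻¹) := by
  -- In the scale `y = √n x` the weight `n x⁴ + x² + n⁻¹` is `n⁻¹ (y⁴ + y² + 1)`; integration in `x`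
  -- supplies the remaining `n^{-1/2}`.
  set g : ℝ → ℝ := fun y => (y ^ 4 + y ^ 2 + 1) * Real.exp (-κ * y ^ 2) with hg
  have hgi : Integrable g := by
    have e : g = fun y => y ^ 4 * Real.exp (-κ * y ^ 2) + y ^ 2 * Real.exp (-κ * y ^ 2) +
        y ^ 0 * Real.exp (-κ * y ^ 2) := by funext y; simp only [hg]; ring
    rw [e]
    exact ((integrable_pow_mul_exp_neg_mul_sq hκ 4).add
      (integrable_pow_mul_exp_neg_mul_sq hκ 2)).add (integrable_pow_mul_exp_neg_mul_sq hκ 0)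
  -- `D₁` also covers the Gaussian model outside `[-R, R]`, where `1 + ‖c‖|x|` is at most a multiple
  -- of `x²`; `D₂` covers the tails of `F`.
  set D₁ := C + (R⁻¹ ^ 2 + ‖c‖ * R⁻¹) with hD₁
  set D₂ := C * (24 / κ ^ 4 * (R⁻¹ ^ 4 + R⁻¹ ^ 2)) with hD₂
  have hD₁0 : 0 ≤ D₁ := by positivity
  have hD₂0 : 0 ≤ D₂ := by positivity
  refine ⟨D₁ * (∫ y, g y) + D₂ * Real.pi, fun s hs hre F hF hin hout => ?_⟩
  set n := ‖s‖ with hn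
  have hn0 : 0 < n := by linarith
  have hre0 : 0 < s.re := lt_of_lt_of_le (by positivity) hre
  obtain ⟨hmi, hmain⟩ := integral_one_add_mul_cexp_neg_mul_sq hre0 c
  set m : ℝ → ℂ := fun x => (1 + c * x) * exp (-s * x ^ 2) with hm
  have hgs : Integrable fun x => g (√n * x) := hgi.comp_mul_left' (by positivity)
  have hbi : Integrable fun x : ℝ =>
      D₁ * (n⁻¹ * g (√n * x)) + D₂ * (n⁻¹ ^ 2 * (1 + x ^ 2)⁻¹) :=
    ((hgs.const_mul _).const_mul _).add ((integrable_inv_one_add_sq.const_mul _).const_mul _)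
  have hgscale : ∀ x : ℝ, n⁻¹ * g (√n * x) =
      (n * x ^ 4 + x ^ 2 + n⁻¹) * Real.exp (-κ * n * x ^ 2) := fun x => by
    have h2 : √n ^ 2 = n := Real.sq_sqrt hn0.le
    have h4 : √n ^ 4 = n ^ 2 := by
      calc √n ^ 4 = (√n ^ 2) ^ 2 := by ring
        _ = n ^ 2 := by rw [h2]
    simp only [hg, mul_pow, h2, h4]
    rw [← mul_assoc (-κ)]
    field_simp
  have hbound : ∀ x : ℝ, ‖F x - m x‖ ≤
      D₁ * (n⁻¹ * g (√n * x)) + D₂ * (n⁻¹ ^ 2 * (1 + x ^ 2)⁻¹) := fun x => by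
    rw [hgscale]
    rcases le_or_gt |x| R with hx | hx
    · calc ‖F x - m x‖ ≤ C * (n * x ^ 4 + x ^ 2 + n⁻¹) * Real.exp (-κ * n * x ^ 2) := hin x hx
        _ ≤ D₁ * ((n * x ^ 4 + x ^ 2 + n⁻¹) * Real.exp (-κ * n * x ^ 2)) + 0 := by
          rw [add_zero, mul_assoc]
          gcongr
          exact le_add_of_nonneg_right (by positivity)
        _ ≤ _ := by gcongr; positivity
    · have hx0 : 0 < |x| := hR.trans hx
      have hinv : |x|⁻¹ ≤ R⁻¹ := inv_anti₀ hR hx.le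
      have hm' : ‖m x‖ ≤ (R⁻¹ ^ 2 + ‖c‖ * R⁻¹) *
          ((n * x ^ 4 + x ^ 2 + n⁻¹) * Real.exp (-κ * n * x ^ 2)) := by
        have h1 : ‖1 + c * (x : ℂ)‖ ≤ (R⁻¹ ^ 2 + ‖c‖ * R⁻¹) * x ^ 2 := by
          calc ‖1 + c * (x : ℂ)‖ ≤ 1 + ‖c‖ * |x| := by
                refine (norm_add_le _ _).trans ?_
                simp
            _ = (|x|⁻¹ ^ 2 + ‖c‖ * |x|⁻¹) * |x| ^ 2 := by field_simp
            _ ≤ (R⁻¹ ^ 2 + ‖c‖ * R⁻¹) * |x| ^ 2 := by gcongr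
            _ = _ := by rw [sq_abs]
        have h2 : ‖exp (-s * (x : ℂ) ^ 2)‖ ≤ Real.exp (-κ * n * x ^ 2) := by
          rw [norm_exp]
          gcongr
          have : (-s * (x : ℂ) ^ 2).re = -s.re * x ^ 2 := by
            rw [← ofReal_pow, re_mul_ofReal, neg_re]
          rw [this]
          nlinarith [sq_nonneg x]
        simp only [hm]
        rw [norm_mul]
        calc _ ≤ ((R⁻¹ ^ 2 + ‖c‖ * R⁻¹) * x ^ 2) * Real.exp (-κ * n * x ^ 2) := by gcongr
          _ ≤ ((R⁻¹ ^ 2 + ‖c‖ * R⁻¹) * (n * x ^ 4 + x ^ 2 + n⁻¹)) *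
              Real.exp (-κ * n * x ^ 2) := by
            gcongr
            have : 0 ≤ n * x ^ 4 := by positivity
            have : 0 ≤ n⁻¹ := by positivity
            linarith
          _ = _ := by ring
      have hF' : ‖F x‖ ≤ D₂ * (n⁻¹ ^ 2 * (1 + x ^ 2)⁻¹) := by
        have h1 : Real.exp (-κ * n * |x|) ≤ 24 / (κ * n * |x|) ^ 4 := by
          have := exp_neg_le_div_pow_four (u := κ * n * |x|) (by positivity)
          convert! this using 2; ring
        have h2 : |x|⁻¹ ^ 4 ≤ (R⁻¹ ^ 4 + R⁻¹ ^ 2) * (1 + x ^ 2)⁻¹ := by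
          rw [le_mul_inv_iff₀ (by positivity), ← sq_abs x]
          calc |x|⁻¹ ^ 4 * (1 + |x| ^ 2) = |x|⁻¹ ^ 4 + |x|⁻¹ ^ 2 := by field_simp
            _ ≤ _ := by gcongr
        have h3 : n⁻¹ ^ 4 ≤ n⁻¹ ^ 2 :=
          pow_le_pow_of_le_one (by positivity) (inv_le_one_of_one_le₀ hs) (by norm_num)
        calc ‖F x‖ ≤ C * Real.exp (-κ * n * |x|) := hout x hx
          _ ≤ C * (24 / (κ * n * |x|) ^ 4) := by gcongr
          _ = C * (24 / κ ^ 4 * (n⁻¹ ^ 4 * |x|⁻¹ ^ 4)) := by field_simp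
          _ ≤ C * (24 / κ ^ 4 * (n⁻¹ ^ 2 * ((R⁻¹ ^ 4 + R⁻¹ ^ 2) * (1 + x ^ 2)⁻¹))) := by gcongr
          _ = _ := by rw [hD₂]; ring
      calc ‖F x - m x‖ ≤ ‖m x‖ + ‖F x‖ := by rw [add_comm]; exact norm_sub_le _ _
        _ ≤ _ := by
          gcongr
          refine hm'.trans ?_
          gcongr
          exact le_add_of_nonneg_left hC
  have hdi : Integrable fun x => F x - m x :=
    hbi.mono' (hF.sub hmi.aestronglyMeasurable) (Eventually.of_forall hbound)
  have hFi : Integrable F := (hdi.add hmi).congr (Eventually.of_forall fun x => by simp)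
  rw [← hmain, ← integral_sub hFi hmi]
  calc ‖∫ x, (F x - m x)‖
      ≤ ∫ x, (D₁ * (n⁻¹ * g (√n * x)) + D₂ * (n⁻¹ ^ 2 * (1 + x ^ 2)⁻¹)) :=
        norm_integral_le_of_norm_le hbi (Eventually.of_forall hbound)
    _ = D₁ * (n⁻¹ * ((√n)⁻¹ * ∫ y, g y)) + D₂ * (n⁻¹ ^ 2 * Real.pi) := by
        rw [integral_add ((hgs.const_mul _).const_mul _)
          ((integrable_inv_one_add_sq.const_mul _).const_mul _), integral_const_mul,
          integral_const_mul, integral_const_mul, integral_const_mul, integral_univ_inv_one_add_sq,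
          Measure.integral_comp_mul_left, abs_of_nonneg (by positivity), smul_eq_mul]
    _ ≤ D₁ * (n⁻¹ * ((√n)⁻¹ * ∫ y, g y)) + D₂ * (n⁻¹ * (√n)⁻¹ * Real.pi) := by
        have : n⁻¹ ≤ (√n)⁻¹ := by
          refine inv_anti₀ (by positivity) ?_
          rw [Real.sqrt_le_left hn0.le]
          nlinarith
        rw [sq]
        have hpi := Real.pi_pos
        gcongr
    _ = _ := by ring

/-! ### Local expansion of the kernel at the saddle. -/

/-- The integrand `exp (-t) t ^ (a + 1) (1 + w / t) ^ (-M)` at `t = σ exp v`, where `σ² = w M`,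
without the factor `σ ^ (a + 1)`. -/
def saddleKernel (a σ : ℂ) (M : ℝ) (v : ℂ) : ℂ :=
  exp ((a + 1) * v - σ * exp v - M * log (1 + σ / M * exp (-v)))

/-- The mean value inequality on the convex half-plane `Re ≤ E`. -/
theorem norm_exp_sub_exp_le_of_re_le {α β : ℂ} {E : ℝ} (hα : α.re ≤ E) (hβ : β.re ≤ E) :
    ‖exp α - exp β‖ ≤ ‖α - β‖ * Real.exp E := by
  have := (convex_halfSpace_re_le E).norm_image_sub_le_of_norm_deriv_le (𝕜 := ℂ) (f := exp)
    (C := Real.exp E) (fun x _ => differentiableAt_exp) (fun x hx => by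
      rw [Complex.deriv_exp, norm_exp]; exact Real.exp_le_exp.2 hx) hβ hα
  rwa [mul_comm] at this

/-- Two applications of `dslope` leave an entire quotient, bounded on the closed disc. -/
theorem exists_norm_sub_linear_le {f : ℂ → ℂ} (hf : Differentiable ℂ f) (R : ℝ) :
    ∃ K, 0 ≤ K ∧ ∀ v, ‖v‖ ≤ R → ‖f v - f 0 - deriv f 0 * v‖ ≤ K * ‖v‖ ^ 2 := by
  have hd : ∀ g : ℂ → ℂ, Differentiable ℂ g → Differentiable ℂ (dslope g 0) := fun g hg => by
    rw [← differentiableOn_univ] at hg ⊢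
    exact (differentiableOn_dslope univ_mem).2 hg
  have hg := hd _ (hd f hf)
  obtain ⟨K, hK⟩ := (isCompact_closedBall (0 : ℂ) R).exists_bound_of_continuousOn
    hg.continuous.continuousOn
  refine ⟨|K|, abs_nonneg K, fun v hv => ?_⟩
  have e₁ : f v - f 0 = v * dslope f 0 v := by
    simpa using (sub_smul_dslope f 0 v).symm
  have e₂ : dslope f 0 v - deriv f 0 = v * dslope (dslope f 0) 0 v := by
    simpa using (sub_smul_dslope (dslope f 0) 0 v).symm
  have e₃ : f v - f 0 - deriv f 0 * v = v ^ 2 * dslope (dslope f 0) 0 v := by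
    linear_combination e₁ + v * e₂
  rw [e₃, norm_mul, norm_pow, mul_comm]
  gcongr
  exact (hK v (by simpa using hv)).trans (le_abs_self K)

/-- Odd Taylor terms of `exp v` and `exp (-v)` cancel, so the remainder has order four. -/
theorem norm_two_mul_cosh_sub_le (v : ℂ) :
    ‖2 * (cosh v - 1) - v ^ 2‖ ≤ 2 * ‖v‖ ^ 4 * Real.exp ‖v‖ := by
  have h₁ := norm_exp_sub_sum_le_norm_mul_exp v 4
  have h₂ := norm_exp_sub_sum_le_norm_mul_exp (-v) 4
  rw [norm_neg] at h₂
  have e : 2 * (cosh v - 1) - v ^ 2 =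
      (exp v - ∑ m ∈ Finset.range 4, v ^ m / m.factorial) +
        (exp (-v) - ∑ m ∈ Finset.range 4, (-v) ^ m / m.factorial) := by
    rw [cosh]
    simp only [Finset.sum_range_succ, Finset.sum_range_zero, Nat.factorial]
    push_cast
    ring
  rw [e]
  refine (norm_add_le _ _).trans ?_
  linarith

theorem norm_log_one_add_sub_quadratic_le {X : ℂ} (hX : ‖X‖ ≤ 1 / 2) :
    ‖log (1 + X) - (X - X ^ 2 / 2)‖ ≤ ‖X‖ ^ 3 := by
  have h := norm_log_sub_logTaylor_le 2 (hX.trans_lt (by norm_num))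
  have e : logTaylor (2 + 1) X = X - X ^ 2 / 2 := by
    simp [logTaylor, Finset.sum_range_succ]
    ring
  rw [e] at h
  refine h.trans ?_
  have : (1 - ‖X‖)⁻¹ ≤ 2 := by
    rw [inv_le_comm₀ (by linarith) (by norm_num)]; linarith
  have h3 : 0 ≤ ‖X‖ ^ 3 := by positivity
  norm_num
  nlinarith

/-- With `X = (σ/M)e^{-v}`, the relation `σ² = wM` gives `MX = σe^{-v}` and `MX² = we^{-2v}`. The
normalized kernel is thus a product `A · B · D`: `A = exp(-2σ(cosh v - 1))` is nearly Gaussian, `B`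
is entire and independent of `M` with `B(0) = 1` and `B'(0) = a + 1 - w`, and `D` carries the cubic
remainder of the logarithm. Replacing `A`, `B`, `D` by their approximations costs the terms
`‖σ‖‖v‖⁴`, `‖v‖²` and `‖σ‖⁻¹` respectively. The variable `v` is complex so that the estimate applies
on both axes. -/
theorem exists_norm_saddleKernel_sub_le (a : ℂ) {w : ℂ} (hw : w ≠ 0) (κ R : ℝ) :
    ∃ C N, 0 ≤ C ∧ 0 < N ∧ ∀ (M : ℝ) (σ : ℂ), N ≤ M → σ ^ 2 = w * M → ∀ v : ℂ, ‖v‖ ≤ R →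
      κ * ‖σ‖ * ‖v‖ ^ 2 ≤ (2 * σ * (cosh v - 1)).re → κ * ‖σ‖ * ‖v‖ ^ 2 ≤ (σ * v ^ 2).re →
      ‖exp (2 * σ - w / 2) * saddleKernel a σ M v - (1 + (a + 1 - w) * v) * exp (-σ * v ^ 2)‖ ≤
        C * (‖σ‖ * ‖v‖ ^ 4 + ‖v‖ ^ 2 + ‖σ‖⁻¹) * Real.exp (-κ * ‖σ‖ * ‖v‖ ^ 2) := by
  set B : ℂ → ℂ := fun v => exp ((a + 1) * v + w / 2 * (exp (-2 * v) - 1)) with hB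
  have hBd : Differentiable ℂ B := by simp only [hB]; fun_prop
  have hB0 : B 0 = 1 := by simp [hB]
  have hB1 : deriv B 0 = a + 1 - w := by
    have h1 : HasDerivAt (fun v : ℂ => exp (-2 * v)) (exp (-2 * 0) * (-2 * 1)) 0 :=
      ((hasDerivAt_id (0 : ℂ)).const_mul (-2)).cexp
    have h2 := (((hasDerivAt_id (0 : ℂ)).const_mul (a + 1)).add
      ((h1.sub_const 1).const_mul (w / 2))).cexp
    have h3 : deriv B 0 = _ := h2.deriv
    rw [h3]
    simp
    ring
  obtain ⟨K₂, hK₂0, hK₂⟩ := exists_norm_sub_linear_le hBd R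
  obtain ⟨K₁, hK₁⟩ := (isCompact_closedBall (0 : ℂ) R).exists_bound_of_continuousOn
    hBd.continuous.continuousOn
  rw [hB0, hB1] at hK₂
  have hw0 : 0 < ‖w‖ := norm_pos_iff.2 hw
  set K₃ := ‖w‖ ^ 2 * Real.exp (3 * R) with hK₃
  set K₄ := (1 + ‖a + 1 - w‖ * |R|) * (2 * Real.exp R) with hK₄
  -- `‖σ‖ ≥ L` ensures both `‖X‖ ≤ 1/2` and `‖Mρ‖ ≤ 1`, where `ρ` is the remainder of the logarithm.
  set L := max (2 * ‖w‖ * Real.exp R) K₃ with hL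
  refine ⟨|K₁| * (2 * K₃) + K₂ + K₄, max 1 (L ^ 2 / ‖w‖), by positivity, by positivity,
    fun M σ hM hσ v hv h₁ h₂ => ?_⟩
  have hM1 : 1 ≤ M := (le_max_left _ _).trans hM
  have hM0 : 0 < M := by linarith
  have hσM : ‖σ‖ ^ 2 = ‖w‖ * M := by
    rw [← norm_pow, hσ, norm_mul, norm_real, Real.norm_of_nonneg hM0.le]
  have hσL : L ≤ ‖σ‖ := by
    refine le_of_sq_le_sq ?_ (norm_nonneg _)
    rw [hσM]
    have := (le_max_right _ _).trans hM
    rwa [div_le_iff₀ hw0, mul_comm] at this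
  have hσ0 : 0 < ‖σ‖ := by
    have : 0 < L := lt_max_of_lt_left (by positivity)
    linarith
  have hσne : σ ≠ 0 := norm_pos_iff.1 hσ0
  have hMne : (M : ℂ) ≠ 0 := ofReal_ne_zero.2 hM0.ne'
  set X := σ / M * exp (-v) with hX
  have hev : Real.exp (-v.re) ≤ Real.exp R :=
    Real.exp_le_exp.2 (((neg_le_abs _).trans (abs_re_le_norm v)).trans hv)
  have hσdiv : ‖σ‖ / M = ‖w‖ / ‖σ‖ := by
    rw [div_eq_div_iff hM0.ne' hσ0.ne', ← sq, hσM]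
  have hXn : ‖X‖ ≤ ‖w‖ / ‖σ‖ * Real.exp R := by
    rw [hX, norm_mul, norm_div, norm_real, Real.norm_of_nonneg hM0.le, hσdiv, norm_exp, neg_re]
    gcongr
  have hXh : ‖X‖ ≤ 1 / 2 := by
    refine hXn.trans ?_
    rw [div_mul_eq_mul_div, div_le_iff₀ hσ0]
    linarith [(le_max_left _ _).trans hσL]
  set ρ := log (1 + X) - (X - X ^ 2 / 2) with hρ
  have hρn : ‖(M : ℂ) * ρ‖ ≤ K₃ * ‖σ‖⁻¹ := by
    rw [norm_mul, norm_real, Real.norm_of_nonneg hM0.le]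
    calc M * ‖ρ‖ ≤ M * ‖X‖ ^ 3 := by gcongr; exact norm_log_one_add_sub_quadratic_le hXh
      _ ≤ M * (‖w‖ / ‖σ‖ * Real.exp R) ^ 3 := by gcongr
      _ = (‖w‖ * M) * ‖w‖ ^ 2 * Real.exp (3 * R) / ‖σ‖ ^ 3 := by
          rw [mul_pow, ← Real.exp_nat_mul]; push_cast; field_simp
      _ = K₃ * ‖σ‖⁻¹ := by rw [← hσM, hK₃]; field_simp
  have hρ1 : ‖-((M : ℂ) * ρ)‖ ≤ 1 := by
    rw [norm_neg]
    refine hρn.trans ?_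
    rw [mul_inv_le_iff₀ hσ0, one_mul]
    exact (le_max_right _ _).trans hσL
  set A := exp (-(2 * σ * (cosh v - 1))) with hA
  set G := exp (-σ * v ^ 2) with hG
  set D := exp (-((M : ℂ) * ρ)) with hD
  set E := Real.exp (-κ * ‖σ‖ * ‖v‖ ^ 2) with hE
  have hsplit : exp (2 * σ - w / 2) * saddleKernel a σ M v = A * B v * D := by
    rw [saddleKernel, hA, hB, hD, ← exp_add, ← exp_add, ← exp_add]
    congr 1
    have e1 : (M : ℂ) * X = σ * exp (-v) := by rw [hX]; field_simp
    have e2 : (M : ℂ) * X ^ 2 = w * exp (-2 * v) := by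
      have : exp (-2 * v) = exp (-v) ^ 2 := by rw [← exp_nat_mul]; congr 1; push_cast; ring
      rw [this, hX, mul_pow, div_pow, hσ]; field_simp
    rw [cosh]
    linear_combination -(M : ℂ) * hρ - e1 + e2 / 2
  have hAn : ‖A‖ ≤ E := by
    rw [hA, norm_exp, neg_re]
    exact Real.exp_le_exp.2 (by linarith)
  have hDn : ‖D - 1‖ ≤ 2 * (K₃ * ‖σ‖⁻¹) := by
    refine (norm_exp_sub_one_le hρ1).trans ?_
    rw [norm_neg]
    gcongr
  have hAG : ‖A - G‖ ≤ ‖σ‖ * (2 * ‖v‖ ^ 4 * Real.exp R) * E := by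
    refine (norm_exp_sub_exp_le_of_re_le (E := -κ * ‖σ‖ * ‖v‖ ^ 2) ?_ ?_).trans ?_
    · rw [neg_re]; linarith
    · rw [neg_mul, neg_re]; linarith
    · have : -(2 * σ * (cosh v - 1)) - -σ * v ^ 2 = -(σ * (2 * (cosh v - 1) - v ^ 2)) := by ring
      rw [this, norm_neg, norm_mul]
      gcongr
      refine (norm_two_mul_cosh_sub_le v).trans ?_
      gcongr
  have hcv : ‖1 + (a + 1 - w) * v‖ ≤ 1 + ‖a + 1 - w‖ * |R| := by
    refine (norm_add_le _ _).trans ?_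
    rw [norm_one, norm_mul]
    gcongr
    exact hv.trans (le_abs_self R)
  have hdecomp : A * B v * D - (1 + (a + 1 - w) * v) * G =
      A * B v * (D - 1) + A * (B v - 1 - (a + 1 - w) * v) + (1 + (a + 1 - w) * v) * (A - G) := by
    ring
  have hBv : ‖B v‖ ≤ |K₁| := (hK₁ v (by simpa using hv)).trans (le_abs_self _)
  rw [hsplit, hdecomp]
  have t1 : ‖A * B v * (D - 1)‖ ≤ E * |K₁| * (2 * (K₃ * ‖σ‖⁻¹)) := by
    rw [norm_mul, norm_mul]; gcongr
  have t2 : ‖A * (B v - 1 - (a + 1 - w) * v)‖ ≤ E * (K₂ * ‖v‖ ^ 2) := by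
    rw [norm_mul]; gcongr; exact hK₂ v hv
  have t3 : ‖(1 + (a + 1 - w) * v) * (A - G)‖ ≤
      (1 + ‖a + 1 - w‖ * |R|) * (‖σ‖ * (2 * ‖v‖ ^ 4 * Real.exp R) * E) := by
    rw [norm_mul]; gcongr
  have s1 : 0 ≤ |K₁| * (2 * K₃) := by positivity
  have s2 : 0 ≤ K₄ := by positivity
  have x1 : 0 ≤ ‖σ‖ * ‖v‖ ^ 4 := by positivity
  have x2 : 0 ≤ ‖v‖ ^ 2 := by positivity
  have x3 : 0 ≤ ‖σ‖⁻¹ := by positivity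
  calc _ ≤ E * |K₁| * (2 * (K₃ * ‖σ‖⁻¹)) + E * (K₂ * ‖v‖ ^ 2) +
        (1 + ‖a + 1 - w‖ * |R|) * (‖σ‖ * (2 * ‖v‖ ^ 4 * Real.exp R) * E) :=
        (norm_add₃_le).trans (add_le_add (add_le_add t1 t2) t3)
    _ = (|K₁| * (2 * K₃) * ‖σ‖⁻¹ + K₂ * ‖v‖ ^ 2 + K₄ * (‖σ‖ * ‖v‖ ^ 4)) * E := by
        rw [hK₄]; ring
    _ ≤ ((|K₁| * (2 * K₃) + K₂ + K₄) * (‖σ‖ * ‖v‖ ^ 4 + ‖v‖ ^ 2 + ‖σ‖⁻¹)) * E := by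
        gcongr
        nlinarith [mul_nonneg s1 x1, mul_nonneg s1 x2, mul_nonneg hK₂0 x1, mul_nonneg hK₂0 x3,
          mul_nonneg s2 x2, mul_nonneg s2 x3]

/-! ### The saddle integral along the real line. -/

theorem sq_le_two_mul_cosh_sub_one (x : ℝ) : x ^ 2 ≤ 2 * (Real.cosh x - 1) := by
  have h1 : Real.cosh x - 1 = 2 * Real.sinh (x / 2) ^ 2 := by
    have h2 := Real.cosh_two_mul (x / 2)
    have h3 := Real.cosh_sq (x / 2)
    rw [mul_div_cancel₀ x two_ne_zero] at h2
    linarith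
  have h4 : |x / 2| ≤ |Real.sinh (x / 2)| := by
    rw [Real.abs_sinh]
    exact Real.self_le_sinh_iff.2 (abs_nonneg _)
  have h5 := sq_le_sq.2 h4
  rw [h1]
  nlinarith

/-- The tangent at `1`. Its slope exceeds `2`, which pays for the normalizing factor `exp (2 s)` in
the right tail. -/
theorem exp_one_mul_le_exp (x : ℝ) : Real.exp 1 * x ≤ Real.exp x := by
  have h := Real.add_one_le_exp (x - 1)
  calc Real.exp 1 * x ≤ Real.exp 1 * Real.exp (x - 1) := by
        gcongr; linarith
    _ = Real.exp x := by rw [← Real.exp_add]; ring_nf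

/-- The counterpart for the left tail, where the decay comes from the logarithm. As `τ → 0` it
becomes `5/2 y ≤ e^y`; a slope between `2` and `e` leaves room on both sides. -/
theorem mul_le_log_one_add_mul_exp {τ y : ℝ} (hτ : 0 < τ) (hτ' : τ ≤ 1 / 50) :
    5 / 2 * τ * y ≤ Real.log (1 + τ * Real.exp y) := by
  rw [Real.le_log_iff_exp_le (by positivity)]
  set q := 5 / 2 * τ with hq
  have hq0 : 0 < q := by positivity
  have hq1 : q ≤ 1 / 20 := by linarith
  have hconv : Real.exp (q * (y - 1)) ≤ 1 - q + q * Real.exp (y - 1) := by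
    have := convexOn_exp.2 (Set.mem_univ (0 : ℝ)) (Set.mem_univ (y - 1))
      (by linarith : 0 ≤ 1 - q) hq0.le (by ring)
    simpa using this
  have hqe : Real.exp q * (1 - q) ≤ 1 := by
    have h := Real.add_one_le_exp (-q)
    calc Real.exp q * (1 - q) ≤ Real.exp q * Real.exp (-q) := by gcongr; linarith
      _ = 1 := by rw [← Real.exp_add]; simp
  have hqe' : Real.exp q * (5 / 2) ≤ Real.exp 1 := by
    have := Real.exp_one_gt_d9
    have hp := Real.exp_pos q
    nlinarith
  have hy' : Real.exp y = Real.exp 1 * Real.exp (y - 1) := by rw [← Real.exp_add]; ring_nf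
  calc Real.exp (q * y) = Real.exp q * Real.exp (q * (y - 1)) := by
        rw [← Real.exp_add]; ring_nf
    _ ≤ Real.exp q * (1 - q + q * Real.exp (y - 1)) := by gcongr
    _ = Real.exp q * (1 - q) + τ * ((Real.exp q * (5 / 2)) * Real.exp (y - 1)) := by
        rw [hq]; ring
    _ ≤ 1 + τ * (Real.exp 1 * Real.exp (y - 1)) := by gcongr
    _ = _ := by rw [hy']

theorem norm_saddleKernel (a σ : ℂ) (M : ℝ) (v : ℂ) :
    ‖saddleKernel a σ M v‖ = Real.exp (((a + 1) * v).re - (σ * exp v).re -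
      M * Real.log ‖1 + σ / M * exp (-v)‖) := by
  rw [saddleKernel, norm_exp, sub_re, sub_re, re_ofReal_mul, log_re]

theorem continuous_saddleKernel_ofReal (a : ℂ) {σ : ℂ} {M : ℝ} (hM : 0 < M) (hσ : 0 < σ.re) :
    Continuous fun x : ℝ => saddleKernel a σ M x := by
  unfold saddleKernel
  refine Continuous.cexp (Continuous.sub (by fun_prop) (continuous_const.mul ?_))
  refine Continuous.clog (by fun_prop) fun x => mem_slitPlane_iff.2 (Or.inl ?_)
  rw [add_re, one_re, ← ofReal_neg, ← ofReal_exp, re_mul_ofReal, div_ofReal_re]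
  positivity

/-- Asymptotics of the saddle point integral along the real line. -/
theorem exists_norm_integral_saddleKernel_sub_le (a : ℂ) {k : ℂ} (hk : 0 < k.re) :
    ∃ C N, 0 < N ∧ ∀ M : ℝ, N ≤ M → ∀ s : ℂ, s = √M * k →
      ‖(∫ x : ℝ, exp (2 * s - k ^ 2 / 2) * saddleKernel a s M x) -
        (Real.pi / s) ^ (1 / 2 : ℂ)‖ ≤ C * (‖s‖⁻¹ * (√‖s‖)⁻¹) := by
  have hk0 : k ≠ 0 := fun h => by simp [h] at hk
  have hkn : 0 < ‖k‖ := norm_pos_iff.2 hk0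
  set c₀ := k.re / ‖k‖ with hc₀
  have hc₀p : 0 < c₀ := by positivity
  obtain ⟨C₁, N₁, hC₁, hN₁, H₁⟩ :=
    exists_norm_saddleKernel_sub_le a (pow_ne_zero 2 hk0) (c₀ / 4) 1
  set D := Real.exp (‖k‖ ^ 2 / 2) with hD
  obtain ⟨C', HL⟩ := exists_norm_integral_sub_gaussian_le (κ := c₀ / 4) (R := 1) (C := C₁ + D)
    (a + 1 - k ^ 2) (by positivity) one_pos (by positivity)
  set m := |a.re + 1| with hm
  -- After `N₁`, the thresholds secure in turn `4m ≤ Re s`, `Re s / M ≤ 1/50` and `1 ≤ ‖s‖`.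
  refine ⟨C', max N₁ (max ((4 * m / k.re) ^ 2) (max ((50 * k.re) ^ 2) ((1 / ‖k‖) ^ 2))),
    lt_max_of_lt_left hN₁, fun M hM s hs => ?_⟩
  have hM₁ : N₁ ≤ M := (le_max_left _ _).trans hM
  have hM' := (le_max_right _ _).trans hM
  have hM₂ := (le_max_left _ _).trans hM'
  have hM'' := (le_max_right _ _).trans hM'
  have hM₃ := (le_max_left _ _).trans hM''
  have hM₄ := (le_max_right _ _).trans hM''
  have hM0 : 0 < M := by linarith
  have hr0 : 0 < √M := Real.sqrt_pos.2 hM0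
  have hsn : ‖s‖ = √M * ‖k‖ := by rw [hs, norm_mul, norm_real, Real.norm_of_nonneg hr0.le]
  have hsre : s.re = √M * k.re := by rw [hs, re_ofReal_mul]
  have hsc : s.re = c₀ * ‖s‖ := by rw [hsre, hsn, hc₀]; field_simp
  have hs0 : 0 < s.re := by rw [hsre]; positivity
  have hs2 : s ^ 2 = k ^ 2 * M := by
    rw [hs, mul_pow, ← ofReal_pow, Real.sq_sqrt hM0.le]; ring
  have hsm : 4 * m ≤ s.re := by
    have := Real.le_sqrt_of_sq_le hM₂
    rw [div_le_iff₀ hk] at this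
    rwa [hsre]
  have hsM : s.re / M ≤ 1 / 50 := by
    have := Real.le_sqrt_of_sq_le hM₃
    rw [hsre, div_le_iff₀ hM0]
    nlinarith [Real.sq_sqrt hM0.le]
  have hs1 : 1 ≤ ‖s‖ := by
    have := Real.le_sqrt_of_sq_le hM₄
    rw [div_le_iff₀ hkn] at this
    rwa [hsn]
  refine HL s hs1 (by rw [hsc]; nlinarith [norm_nonneg s]) _
    ((continuous_saddleKernel_ofReal a hM0 hs0).const_mul _).aestronglyMeasurable
    (fun x hx => ?_) fun x hx => ?_
  · have hcosh := sq_le_two_mul_cosh_sub_one x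
    have hb : c₀ / 4 * ‖s‖ * x ^ 2 ≤ s.re * x ^ 2 := by
      rw [hsc]; nlinarith [mul_nonneg (mul_nonneg hc₀p.le (norm_nonneg s)) (sq_nonneg x)]
    have := H₁ M s hM₁ hs2 x (by simpa using hx) ?_ ?_
    · refine this.trans ?_
      simp only [norm_real, Real.norm_eq_abs, sq_abs]
      have e4 : |x| ^ 4 = x ^ 4 := (even_two_mul 2).pow_abs x
      rw [e4]
      rw [show -(c₀ / 4) = -c₀ / 4 by ring]
      gcongr
      exact le_add_of_nonneg_right (by positivity)
    · rw [norm_real, Real.norm_eq_abs, sq_abs]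
      have : (2 * s * (cosh x - 1)).re = s.re * (2 * (Real.cosh x - 1)) := by
        rw [← ofReal_cosh, ← ofReal_one, ← ofReal_sub, re_mul_ofReal]
        simp; ring
      rw [this]
      exact hb.trans (by gcongr)
    · rw [norm_real, Real.norm_eq_abs, sq_abs, ← ofReal_pow, re_mul_ofReal]
      exact hb
  · have hfac : ‖exp (2 * s - k ^ 2 / 2)‖ ≤ D * Real.exp (2 * s.re) := by
      rw [norm_exp, hD, ← Real.exp_add]
      refine Real.exp_le_exp.2 ?_
      have h1 : -(k ^ 2 / 2).re ≤ ‖k‖ ^ 2 / 2 := by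
        refine (neg_le_abs _).trans ((abs_re_le_norm _).trans ?_)
        simp
      have h2 : (2 * s).re = 2 * s.re := by simp
      rw [sub_re, h2]
      linarith
    have e1 : ((a + 1) * x).re = (a.re + 1) * x := by rw [re_mul_ofReal]; simp
    have e2 : (s * exp x).re = s.re * Real.exp x := by rw [← ofReal_exp, re_mul_ofReal]
    have hmx : (a.re + 1) * x ≤ m * |x| := by
      rw [hm, ← abs_mul]; exact le_abs_self _
    have hnorm : 1 + s.re / M * Real.exp (-x) ≤ ‖1 + s / M * exp (-x)‖ := by
      refine le_trans (le_of_eq ?_) (re_le_norm _)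
      rw [add_re, one_re, ← ofReal_neg, ← ofReal_exp, re_mul_ofReal, div_ofReal_re]
    have hpos : 0 < s.re / M * Real.exp (-x) := by positivity
    -- For `x > 1` the term `s e^x` outweighs `2s`; for `x < -1` the logarithm does. The condition
    -- `4m ≤ Re s` absorbs the factor `e^{(a+1)x}`.
    have key : 2 * s.re + ((a.re + 1) * x - s.re * Real.exp x -
        M * Real.log ‖1 + s / M * exp (-x)‖) ≤ -(c₀ / 4) * ‖s‖ * |x| := by
      have hrw : -(c₀ / 4) * ‖s‖ * |x| = -(s.re / 4) * |x| := by rw [hsc]; ring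
      rw [hrw]
      rcases le_total 0 x with hx0 | hx0
      · rw [abs_of_nonneg hx0] at hx hmx ⊢
        have hlog : 0 ≤ M * Real.log ‖1 + s / M * exp (-x)‖ :=
          mul_nonneg hM0.le (Real.log_nonneg (by linarith))
        have hexp : 27 / 10 * x ≤ Real.exp x := by
          have := Real.exp_one_gt_d9
          nlinarith [exp_one_mul_le_exp x]
        have h1 : s.re * (27 / 10 * x) ≤ s.re * Real.exp x := by gcongr
        have h2 : 4 * m * x ≤ s.re * x := by gcongr
        have h3 : s.re * 1 ≤ s.re * x := by gcongr
        linarith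
      · rw [abs_of_nonpos hx0] at hx hmx ⊢
        have hlog : M * (5 / 2 * (s.re / M) * (-x)) ≤ M * Real.log ‖1 + s / M * exp (-x)‖ := by
          gcongr
          refine (mul_le_log_one_add_mul_exp (by positivity) hsM).trans ?_
          exact Real.log_le_log (by positivity) hnorm
        have hrw' : M * (5 / 2 * (s.re / M) * (-x)) = 5 / 2 * s.re * (-x) := by field_simp
        rw [hrw'] at hlog
        have h1 : 0 ≤ s.re * Real.exp x := by positivity
        have h2 : 4 * m * (-x) ≤ s.re * (-x) := by gcongr
        have h3 : s.re * 1 ≤ s.re * (-x) := by gcongr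
        linarith
    rw [norm_mul, norm_saddleKernel, e1, e2]
    calc _ ≤ (D * Real.exp (2 * s.re)) * Real.exp ((a.re + 1) * x - s.re * Real.exp x -
          M * Real.log ‖1 + s / M * exp (-x)‖) := by gcongr
      _ = D * Real.exp (2 * s.re + ((a.re + 1) * x - s.re * Real.exp x -
          M * Real.log ‖1 + s / M * exp (-x)‖)) := by rw [Real.exp_add (2 * s.re)]; ring
      _ ≤ D * Real.exp (-(c₀ / 4) * ‖s‖ * |x|) := by gcongr
      _ ≤ _ := by
        gcongr
        exact le_add_of_nonneg_left hC₁

/-! ### Rotation of the collapsed integral through the saddle. -/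

theorem integral_Ioi_eq_integral_exp_mul {E : Type*} [NormedAddCommGroup E] [NormedSpace ℝ E]
    (g : ℝ → E) : ∫ t in Set.Ioi (0 : ℝ), g t = ∫ x : ℝ, Real.exp x • g (Real.exp x) := by
  have := integral_image_eq_integral_abs_deriv_smul (MeasurableSet.univ (α := ℝ))
    (fun x _ => (Real.hasDerivAt_exp x).hasDerivWithinAt) Real.exp_injective.injOn g
  simpa [Set.image_univ, Real.range_exp] using this

/-- Since `Im (z - e^x) > 0`, passing from `z - e^x` to `e^x - z = e^x (1 - z e^{-x})` costs the
factor `e^{-πiM}`. -/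
theorem cpow_mul_sub_cpow_of_pos (z a : ℂ) (hz : 0 < z.im) (M x : ℝ) :
    exp x * (exp (-exp x) * exp x ^ ((M : ℂ) + a) * (z - exp x) ^ (-(M : ℂ))) =
      exp (-(Real.pi * I * M)) * exp ((a + 1) * x - exp x - M * log (1 + -z * exp (-x))) := by
  have hx : exp (x : ℂ) = (Real.exp x : ℂ) := (ofReal_exp x).symm
  have hlog : log (exp (x : ℂ)) = x := by
    rw [hx, ← ofReal_log (Real.exp_pos x).le, Real.log_exp]
  have hu : 0 < (z - exp (x : ℂ)).im := by rw [hx]; simpa using hz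
  have h1 : exp (x : ℂ) + -z = (Real.exp x : ℂ) * (1 + -z * exp (-x)) := by
    rw [exp_neg, hx]
    have : (Real.exp x : ℂ) ≠ 0 := ofReal_ne_zero.2 (Real.exp_pos x).ne'
    field_simp
  have h2 : exp (x : ℂ) + -z ≠ 0 := fun h => by
    have := congrArg Complex.im h
    rw [hx] at this
    simp at this
    exact hz.ne' this
  have h3 : 1 + -z * exp (-(x : ℂ)) ≠ 0 := fun h => h2 (by rw [h1, h, mul_zero])
  have h4 : log (exp (x : ℂ) + -z) = x + log (1 + -z * exp (-x)) := by
    rw [h1, log_ofReal_mul (Real.exp_pos x) h3, Real.log_exp]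
  have h5 := neg_cpow_of_im_pos hu (-(M : ℂ))
  rw [neg_sub, sub_eq_add_neg, cpow_def_of_ne_zero h2, h4] at h5
  have h6 : (z - exp (x : ℂ)) ^ (-(M : ℂ)) = exp (-(Real.pi * I * M)) *
      exp ((x + log (1 + -z * exp (-x))) * -(M : ℂ)) := by
    rw [h5, ← mul_assoc, ← exp_add]; simp
  rw [h6, cpow_def_of_ne_zero (exp_ne_zero _), hlog, ← exp_add, ← exp_add, ← exp_add, ← exp_add,
    ← exp_add]
  congr 1
  ring

theorem sq_mul_exp_neg_im {k : ℂ} (hk : k ≠ 0) (ζ : ℂ) :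
    (k ^ 2 * exp (-ζ)).im =
      Real.exp (2 * Real.log ‖k‖ - ζ.re) * Real.sin (2 * arg k - ζ.im) := by
  have : k ^ 2 * exp (-ζ) = exp (2 * log k - ζ) := by
    rw [sub_eq_add_neg, exp_add, two_mul, exp_add, exp_log hk, sq]
  rw [this, exp_im]
  simp [log_re, log_im]

/-- Rotation of the ray of integration from the positive axis to the direction of `k`. -/
theorem integral_eq_cpow_mul_integral_saddleKernel (a : ℂ) {k : ℂ} (hk : 0 < k.re)
    (hk' : k.im < 0) {M : ℝ} (hM : 0 < M) (hMa : 1 ≤ M + a.re + 1) {s : ℂ} (hs : s = √M * k) :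
    ∫ x : ℝ, exp ((a + 1) * x - exp x - M * log (1 + k ^ 2 * exp (-x))) =
      s ^ (a + 1) * ∫ x : ℝ, saddleKernel a s M x := by
  have hk0 : k ≠ 0 := fun h => by simp [h] at hk
  have hr0 : 0 < √M := Real.sqrt_pos.2 hM
  set α := arg k with hα
  have hα0 : α < 0 := arg_neg_iff.2 hk'
  have hα1 : -(Real.pi / 2) < α := (abs_lt.1 (abs_arg_lt_pi_div_two_iff.2 (Or.inl hk))).1
  have hpi := Real.pi_pos
  set f : ℂ → ℂ := fun ζ => exp ((a + 1) * ζ - exp ζ - M * log (1 + k ^ 2 * exp (-ζ))) with hf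
  -- For `y ∈ [α, 0]` the angle `2α - y` lies in `[2α, α] ⊂ (-π, 0)`, so `1 + k² e^{-ζ}` stays in
  -- the lower half-plane throughout the strip; compactness makes the bound on the sine uniform.
  obtain ⟨y₁, hy₁, hsin⟩ := isCompact_Icc.exists_isMaxOn (Set.nonempty_Icc.2 hα0.le)
    (f := fun y => Real.sin (2 * α - y)) (by fun_prop)
  set δ := -Real.sin (2 * α - y₁) with hδ
  have hδ0 : 0 < δ := by
    rw [hδ, neg_pos]
    exact Real.sin_neg_of_neg_of_neg_pi_lt (by linarith [hy₁.1]) (by linarith [hy₁.2])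
  have hsinle : ∀ y ∈ Set.Icc α 0, Real.sin (2 * α - y) ≤ -δ := fun y hy => by
    rw [hδ, neg_neg]; exact hsin hy
  set ω := Real.exp (2 * Real.log ‖k‖) with hω
  have him : ∀ ζ : ℂ, ζ.im ∈ Set.Icc α 0 →
      (1 + k ^ 2 * exp (-ζ)).im ≤ -(ω * δ * Real.exp (-ζ.re)) := fun ζ hζ => by
    rw [add_im, one_im, zero_add, sq_mul_exp_neg_im hk0, sub_eq_add_neg _ ζ.re, Real.exp_add]
    have := hsinle _ hζ
    have h0 : 0 < ω * Real.exp (-ζ.re) := by positivity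
    nlinarith
  set c := Real.cos α with hc
  have hc0 : 0 < c := Real.cos_pos_of_mem_Ioo ⟨hα1, by linarith⟩
  -- The lower bound on the logarithm's argument adds `M` to the growth exponent `Re a + 1`. As `b ≥
  -- 1`, `e^{bx}` decays to the left; to the right `exp(-c e^x)` takes over.
  set b := M + a.re + 1 with hb
  obtain ⟨C₁, hC₁0, hC₁⟩ := exists_norm_cpow_le_exp ((b + 1 : ℝ) : ℂ) one_pos hc0
  set K := Real.exp (|a.im| * |α|) * (ω * δ) ^ (-M) with hK
  have hbound : ∀ ζ : ℂ, ζ.im ∈ Set.Icc α 0 →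
      ‖f ζ‖ ≤ K * (Real.exp (b * ζ.re) * Real.exp (-(c * Real.exp ζ.re))) := fun ζ hζ => by
    have h1 : ω * δ * Real.exp (-ζ.re) ≤ ‖1 + k ^ 2 * exp (-ζ)‖ := by
      have := him ζ hζ
      linarith [(neg_le_abs _).trans (abs_im_le_norm (1 + k ^ 2 * exp (-ζ)))]
    have h2 : Real.log (ω * δ) - ζ.re ≤ Real.log ‖1 + k ^ 2 * exp (-ζ)‖ := by
      have := Real.log_le_log (by positivity) h1
      rwa [Real.log_mul (by positivity) (by positivity), Real.log_exp, ← sub_eq_add_neg] at this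
    have h3 : ((a + 1) * ζ).re ≤ (a.re + 1) * ζ.re + |a.im| * |α| := by
      have : -(a.im * ζ.im) ≤ |a.im| * |α| := by
        refine (neg_le_abs _).trans ?_
        rw [abs_mul]
        refine mul_le_mul_of_nonneg_left ?_ (abs_nonneg _)
        rw [abs_of_nonpos hζ.2, abs_of_neg hα0]
        linarith [hζ.1]
      simp only [mul_re, add_re, one_re, add_im, one_im, add_zero]
      linarith
    have h4 : c * Real.exp ζ.re ≤ (exp ζ).re := by
      rw [exp_re, mul_comm]
      gcongr
      rw [hc, ← Real.cos_neg ζ.im, ← Real.cos_neg α]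
      exact Real.cos_le_cos_of_nonneg_of_le_pi (by linarith [hζ.2]) (by linarith)
        (by linarith [hζ.1])
    rw [hf, norm_exp, sub_re, sub_re, re_ofReal_mul, log_re, hK,
      Real.rpow_def_of_pos (by positivity), ← Real.exp_add, ← Real.exp_add, ← Real.exp_add]
    refine Real.exp_le_exp.2 ?_
    have h5 := mul_le_mul_of_nonneg_left h2 hM.le
    rw [hb]
    linarith
  have hK0 : 0 < K := by positivity
  have hdecay : ∀ x : ℝ, ∀ y ∈ Set.Icc α 0,
      ‖f (x + y * I)‖ ≤ K * (C₁ + 1) * Real.exp (-1 * |x|) := fun x y hy => by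
    have h := hbound (x + y * I) (by simpa using hy)
    simp only [add_re, ofReal_re, mul_re, I_re, mul_zero, ofReal_im, I_im, mul_one, sub_self,
      add_zero] at h
    refine h.trans ?_
    rw [mul_assoc K (C₁ + 1)]
    refine mul_le_mul_of_nonneg_left ?_ hK0.le
    rcases le_total 0 x with hx | hx
    · rw [abs_of_nonneg hx]
      have h1 := hC₁ (Real.exp x : ℂ) (by
        rw [norm_real, Real.norm_of_nonneg (Real.exp_pos x).le]; exact Real.one_le_exp hx)
      rw [← ofReal_cpow (Real.exp_pos x).le, norm_real, norm_real,
        Real.norm_of_nonneg (by positivity), Real.norm_of_nonneg (by positivity),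
        ← Real.exp_mul] at h1
      calc Real.exp (b * x) * Real.exp (-(c * Real.exp x))
          = Real.exp (x * (b + 1)) * Real.exp (-(c * Real.exp x)) * Real.exp (-1 * x) := by
            rw [← Real.exp_add, ← Real.exp_add, ← Real.exp_add]; ring_nf
        _ ≤ C₁ * Real.exp (c * Real.exp x) * Real.exp (-(c * Real.exp x)) *
            Real.exp (-1 * x) := by gcongr
        _ = C₁ * Real.exp (-1 * x) := by
            rw [mul_assoc C₁, ← Real.exp_add, add_neg_cancel, Real.exp_zero, mul_one]
        _ ≤ _ := by gcongr; linarith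
    · rw [abs_of_nonpos hx]
      calc Real.exp (b * x) * Real.exp (-(c * Real.exp x)) ≤ Real.exp (-1 * -x) * 1 := by
            refine mul_le_mul (Real.exp_le_exp.2 (by nlinarith)) (Real.exp_le_one_iff.2 ?_)
              (Real.exp_pos _).le (Real.exp_pos _).le
            exact neg_nonpos.2 (mul_nonneg hc0.le (Real.exp_pos x).le)
        _ ≤ _ := by
            rw [mul_comm]
            gcongr
            linarith
  have hd : DifferentiableOn ℂ f (Set.univ ×ℂ Set.Icc α 0) := fun ζ hζ => by
    refine (DifferentiableAt.cexp (DifferentiableAt.sub (by fun_prop)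
      ((differentiableAt_const _).mul (DifferentiableAt.clog (by fun_prop)
        (mem_slitPlane_iff.2 (Or.inr (ne_of_lt ?_))))))).differentiableWithinAt
    refine (him ζ hζ.2).trans_lt ?_
    rw [neg_lt_zero]
    positivity
  have hshift := integral_horizontal_eq_of_exp_decay hα0.le one_pos hd hdecay
  have h0 : (∫ x : ℝ, f (x + ((0 : ℝ) : ℂ) * I)) = ∫ x : ℝ, f x := by simp
  have hs0 : s ≠ 0 := by
    rw [hs]; exact mul_ne_zero (ofReal_ne_zero.2 hr0.ne') hk0
  have hlogs : log s = Real.log ‖s‖ + α * I := by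
    rw [log, hs, arg_real_mul k hr0]
  have hsM : k ^ 2 / s = s / M := by
    rw [div_eq_div_iff hs0 (ofReal_ne_zero.2 hM.ne'), hs]
    have : ((√M : ℝ) : ℂ) ^ 2 = M := by rw [← ofReal_pow, Real.sq_sqrt hM.le]
    linear_combination -k ^ 2 * this
  calc ∫ x : ℝ, f x = ∫ x : ℝ, f (x + α * I) := by rw [← h0, ← hshift]
    -- The vertical shift by `α` and this translation together replace `ζ` by `log s + x`; then
    -- `k²/s = s/M` identifies the kernel.
    _ = ∫ x : ℝ, f ((x + Real.log ‖s‖ : ℝ) + α * I) :=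
      (integral_add_right_eq_self (fun x : ℝ => f (x + α * I)) (Real.log ‖s‖)).symm
    _ = ∫ x : ℝ, s ^ (a + 1) * saddleKernel a s M x := by
      refine integral_congr_ae (Eventually.of_forall fun x => ?_)
      have e : ((x + Real.log ‖s‖ : ℝ) : ℂ) + α * I = log s + x := by
        rw [hlogs]; push_cast; ring
      simp only [e, hf, saddleKernel]
      rw [cpow_def_of_ne_zero hs0, ← exp_add, neg_add, exp_add (log s), exp_add (-log s),
        exp_neg (log s), exp_log hs0, ← hsM, ← mul_assoc (k ^ 2), ← div_eq_mul_inv]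
      congr 1
      ring
    _ = _ := integral_const_mul _ _

theorem HankelLoop.IsInner.integral_loopIntegrand_eq_saddle {C : HankelLoop} {z a : ℂ}
    (hz : 0 < z.im) (hC : C.IsInner z) {k : ℂ} (hk : 0 < k.re) (hk' : k.im < 0)
    (hkz : k ^ 2 = -z) {M : ℝ} (hM : 0 < M) (hMa : 0 < M + a.re) {s : ℂ} (hs : s = √M * k) :
    C.integral (loopIntegrand z a M) =
      (exp (2 * Real.pi * I * (M + a)) - 1) * exp (-(Real.pi * I * a) - 2 * Real.pi * I * M) *
        (s ^ (a + 1) * ∫ x : ℝ, saddleKernel a s M x) := by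
  rw [hC.integral_loopIntegrand (by simpa using hMa), integral_Ioi_eq_integral_exp_mul,
    ← integral_eq_cpow_mul_integral_saddleKernel a hk hk' hM (by linarith) hs, hkz]
  have e : ∀ x : ℝ, Real.exp x • (exp (-(Real.exp x : ℂ)) * (Real.exp x : ℂ) ^ ((M : ℂ) + a) *
      (z - (Real.exp x : ℂ)) ^ (-(M : ℂ))) =
      exp (-(Real.pi * I * M)) * exp ((a + 1) * x - exp x - M * log (1 + -z * exp (-x))) := by
    intro x
    rw [real_smul, ofReal_exp]
    exact cpow_mul_sub_cpow_of_pos z a hz M x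
  simp only [e]
  rw [integral_const_mul, ← mul_assoc]
  congr 1
  rw [sub_mul, sub_mul, ← exp_add, ← exp_add, ← exp_add, one_mul]
  congr 2 <;> ring

/-! ### Reduction of the outer loop to a segment of the imaginary axis. -/

/-- A loop around `0` and `z` may be enlarged. -/
theorem HankelLoop.IsOuter.integral_eq_of_le {C D : HankelLoop} {z a : ℂ} {M : ℝ} (hz : 0 < z.im)
    (hC : C.IsOuter z) (hl : C.left ≤ D.left) (hu : C.up ≤ D.up) (hd : C.down ≤ D.down) :
    C.integral (loopIntegrand z a M) = D.integral (loopIntegrand z a M) := by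
  obtain ⟨hCz, hCu⟩ := hC
  have hup := C.up_pos
  have hdn := C.down_pos
  have hlp := C.left_pos
  set f := loopIntegrand z a M with hf
  have hdiff : ∀ t : ℂ, (t.re < 0 ∧ t.re < z.re) ∨ C.up ≤ t.im ∨ t.im ≤ -C.down →
      DifferentiableAt ℂ f t := fun t ht => by
    refine differentiableAt_loopIntegrand ?_ ?_ <;> rw [mem_slitPlane_iff]
    · rcases ht with h | h | h
      · left; rw [neg_re]; linarith [h.1]
      · right; rw [neg_im]; linarith
      · right; rw [neg_im]; linarith
    · rcases ht with h | h | h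
      · left; rw [sub_re]; linarith [h.2]
      · right; rw [sub_im]; linarith
      · right; rw [sub_im]; linarith
  have hcont : ∀ s : Set ℂ, (∀ t ∈ s, (t.re < 0 ∧ t.re < z.re) ∨ C.up ≤ t.im ∨ t.im ≤ -C.down) →
      ContinuousOn f s := fun s hs t ht => (hdiff t (hs t ht)).continuousAt.continuousWithinAt
  obtain ⟨B, hB⟩ := exists_norm_loopIntegrand_le z a M (D.up + D.down)
  have hDu := D.up_pos
  have hDd := D.down_pos
  have hBy : ∀ y ∈ Set.Icc (-D.down) D.up, |y| ≤ D.up + D.down := fun y hy =>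
    abs_le.2 ⟨by linarith [hy.1], by linarith [hy.2]⟩
  -- The region between the loops consists of an upper half-strip, a lower half-strip and a
  -- rectangle on the left.
  have H₁ := integral_boundary_halfStrip (f := f) (x₀ := -D.left) hu (by norm_num)
    (hcont _ fun t ht => Or.inr (Or.inl ht.2.1))
    (fun t ht => (hdiff t (Or.inr (Or.inl ht.2.1.le))).differentiableWithinAt)
    (fun x hx y hy => hB x hx y (hBy y ⟨by linarith [hy.1], hy.2⟩))
  have H₂ := integral_boundary_halfStrip (f := f) (x₀ := -D.left) (neg_le_neg hd) (by norm_num)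
    (hcont _ fun t ht => Or.inr (Or.inr ht.2.2))
    (fun t ht => (hdiff t (Or.inr (Or.inr ht.2.2.le))).differentiableWithinAt)
    (fun x hx y hy => hB x hx y (hBy y ⟨hy.1, by linarith [hy.2]⟩))
  have hll : -D.left ≤ -C.left := neg_le_neg hl
  have hdu : -C.down ≤ C.up := by linarith
  have H₃ := integral_boundary_rect_eq_zero_of_continuousOn_of_differentiableOn f
    ((-D.left : ℝ) + (-C.down : ℝ) * I) ((-C.left : ℝ) + (C.up : ℝ) * I)
    (hcont _ fun t ht => Or.inl (by
      have := ht.1.2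
      simp [hll] at this
      constructor <;> linarith))
    (fun t ht => (hdiff t (Or.inl (by
      have := ht.1.2
      simp [hll] at this
      constructor <;> linarith))).differentiableWithinAt)
  simp only [add_re, ofReal_re, mul_re, I_re, mul_zero, ofReal_im, I_im, mul_one, sub_self,
    add_zero, add_im, mul_im, zero_add, smul_eq_mul] at H₃
  have hline : ∀ y ∈ Set.Icc (-D.down) D.up, C.up ≤ y ∨ y ≤ -C.down →
      IntegrableOn (fun x : ℝ => f (x + y * I)) (Set.Ioi (-D.left)) ∧
      ∫ x in Set.Ioi (-D.left), f (x + y * I) =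
        (∫ x in (-D.left)..(-C.left), f (x + y * I)) +
          ∫ x in Set.Ioi (-C.left), f (x + y * I) := by
    intro y hy hy'
    have i₁ : IntegrableOn (fun x : ℝ => f (x + y * I)) (Set.Ioi (-D.left)) := by
      refine integrableOn_horizontal_of_exp_decay (by norm_num) ?_
        (fun x hx => hB x hx y (hBy y hy))
      exact (hcont {t | t.im = y} fun t ht => Or.inr (by rwa [ht])).comp (by fun_prop)
        fun x _ => by simp
    refine ⟨i₁, ?_⟩
    rw [intervalIntegral.integral_interval_add_Ioi i₁ (i₁.mono_set (Set.Ioi_subset_Ioi hll))]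
  have hvert : ∀ u v : ℝ, IntervalIntegrable (fun y : ℝ => f ((-D.left : ℝ) + y * I))
      volume u v := fun u v => by
    refine Continuous.intervalIntegrable ?_ _ _
    rw [← continuousOn_univ]
    refine (hcont {t | t.re = -D.left} fun t ht => Or.inl ?_).comp (by fun_prop) fun y _ => by simp
    replace ht : t.re = -D.left := ht
    constructor <;> linarith
  have l₁ := (hline C.up ⟨by linarith, hu⟩ (Or.inl le_rfl)).2
  have l₂ := (hline (-C.down) ⟨by linarith, by linarith⟩ (Or.inr le_rfl)).2
  have hv : (∫ y in (-D.down)..D.up, f ((-D.left : ℝ) + y * I)) =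
      (∫ y in (-D.down)..(-C.down), f ((-D.left : ℝ) + y * I)) +
      (∫ y in (-C.down)..C.up, f ((-D.left : ℝ) + y * I)) +
      ∫ y in C.up..D.up, f ((-D.left : ℝ) + y * I) := by
    rw [intervalIntegral.integral_add_adjacent_intervals (hvert _ _) (hvert _ _),
      intervalIntegral.integral_add_adjacent_intervals (hvert _ _) (hvert _ _)]
  simp only [HankelLoop.integral, sub_eq_add_neg _ (_ * I), ← neg_mul, ← ofReal_neg]
  rw [hv]
  linear_combination -H₁ + l₁ - H₂ - l₂ - H₃

/-- The argument of `z - t` splits along a loop around `0` and `z` on which `‖z‖ < ‖t‖`. -/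
theorem log_sub_eq_log_neg_add {z t : ℂ} (hzt : ‖z‖ < ‖t‖)
    (h : t.re < 0 ∨ (0 < t.im ∧ z.im < t.im) ∨ (t.im < 0 ∧ t.im < z.im)) :
    log (z - t) = log (-t) + log (1 + -z / t) := by
  have ht0 : t ≠ 0 := norm_pos_iff.1 ((norm_nonneg z).trans_lt hzt)
  have hre : 0 < (1 + -z / t).re := by
    have h1 : ‖-z / t‖ < 1 := by
      rw [norm_div, norm_neg, div_lt_one (norm_pos_iff.2 ht0)]; exact hzt
    have h2 := (abs_lt.1 ((abs_re_le_norm (-z / t)).trans_lt h1)).1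
    rw [add_re, one_re]; linarith
  have hv0 : 1 + -z / t ≠ 0 := fun e => by simp [e] at hre
  have hprod : z - t = -t * (1 + -z / t) := by field_simp; ring
  have hθ := abs_lt.1 (abs_arg_lt_pi_div_two_iff.2 (Or.inl hre))
  have hpi := Real.pi_pos
  -- If the sum of the arguments left `(-π, π]`, its sine, and hence `Im (z - t)`, would have the
  -- wrong sign.
  have him : (z - t).im = ‖-t‖ * ‖1 + -z / t‖ * Real.sin (arg (-t) + arg (1 + -z / t)) := by
    have e : z - t = ((‖-t‖ * ‖1 + -z / t‖ : ℝ) : ℂ) *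
        exp (((arg (-t) + arg (1 + -z / t) : ℝ) : ℂ) * I) := by
      conv_lhs => rw [hprod, ← norm_mul_exp_arg_mul_I (-t), ← norm_mul_exp_arg_mul_I (1 + -z / t)]
      push_cast
      rw [add_mul, exp_add]; ring
    rw [e, im_ofReal_mul, exp_ofReal_mul_I_im]
  have hpos : 0 < ‖-t‖ * ‖1 + -z / t‖ := by
    have := norm_pos_iff.2 hv0
    have := norm_pos_iff.2 (neg_ne_zero.2 ht0)
    positivity
  rw [hprod, log_mul_eq_add_log_iff (neg_ne_zero.2 ht0) hv0]
  rcases h with h | ⟨h, h'⟩ | ⟨h, h'⟩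
  · have := abs_lt.1 (abs_arg_lt_pi_div_two_iff.2 (Or.inl (show 0 < (-t).re by simpa using h)))
    constructor <;> linarith [this.1, this.2]
  · have h1 : arg (-t) < 0 := arg_neg_iff.2 (by simpa using h)
    have h2 := neg_pi_lt_arg (-t)
    refine ⟨?_, by linarith⟩
    by_contra! hc
    have hs : 0 ≤ Real.sin (arg (-t) + arg (1 + -z / t)) := by
      rw [← Real.sin_add_two_pi]
      exact Real.sin_nonneg_of_nonneg_of_le_pi (by linarith) (by linarith)
    have := mul_nonneg hpos.le hs
    rw [← him, sub_im] at this
    linarith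
  · have h1 : 0 ≤ arg (-t) := arg_nonneg_iff.2 (by simpa using h.le)
    have h2 := arg_le_pi (-t)
    refine ⟨by linarith, ?_⟩
    by_contra! hc
    have hs : Real.sin (arg (-t) + arg (1 + -z / t)) ≤ 0 := by
      rw [← Real.sin_sub_two_pi]
      exact Real.sin_nonpos_of_nonpos_of_neg_pi_le (by linarith) (by linarith)
    have := mul_nonpos_of_nonneg_of_nonpos hpos.le hs
    rw [← him, sub_im] at this
    linarith

/-- The substitution is `t = -s e^v` with `v = log (-t) - log s`; the factor `-t` is `-dt/dv`. -/
theorem cpow_mul_saddleKernel_log {z a s : ℂ} {M : ℝ} (hM : M ≠ 0) (hs : s ^ 2 = -z * M)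
    (hs0 : s ≠ 0) {t : ℂ} (ht0 : t ≠ 0) (hlog : log (z - t) = log (-t) + log (1 + -z / t))
    (hzt : z - t ≠ 0) :
    s ^ (a + 1) * saddleKernel a (-s) M (log (-t) - log s) = -t * loopIntegrand z a M t := by
  have hMne : (M : ℂ) ≠ 0 := ofReal_ne_zero.2 hM
  have hnt : -t ≠ 0 := neg_ne_zero.2 ht0
  have e1 : exp (log (-t) - log s) = -t / s := by rw [exp_sub, exp_log hnt, exp_log hs0]
  have e2 : -s / M * exp (-(log (-t) - log s)) = -z / t := by
    rw [exp_neg, e1]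
    field_simp
    linear_combination hs
  rw [saddleKernel, e1, e2, loopIntegrand, cpow_def_of_ne_zero hs0, cpow_def_of_ne_zero hnt,
    cpow_def_of_ne_zero hzt, hlog, ← exp_add, ← exp_add, ← exp_add]
  refine Eq.trans ?_ (congrArg (· * _) (exp_log hnt))
  rw [← exp_add]
  congr 1
  field_simp
  ring

/-- The corner values telescope, and only the two far ends remain; the sign in `Q' = -f` makes this
the value at the start minus the value at the end. -/
theorem HankelLoop.tendsto_sub_of_hasDerivAt (C : HankelLoop) {f Q : ℂ → ℂ}
    (hf : C.Converges f) (hQ : ∀ t ∈ C.carrier, HasDerivAt Q (-f t) t) :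
    Tendsto (fun X : ℝ => Q (X + C.up * I) - Q (X - C.down * I)) atTop (nhds (C.integral f)) := by
  obtain ⟨hf₁, hf₂, hf₃⟩ := hf
  have hdu : -C.down ≤ C.up := by linarith [C.up_pos, C.down_pos]
  have hline : ∀ (c : ℂ), IntegrableOn (fun x : ℝ => f (x + c)) (Set.Ioi (-C.left)) →
      (∀ x : ℝ, -C.left ≤ x → (x : ℂ) + c ∈ C.carrier) → ∀ X : ℝ, -C.left ≤ X →
      ∫ x in (-C.left)..X, f (x + c) = Q ((-C.left : ℝ) + c) - Q (X + c) := by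
    intro c hi hc X hX
    have := intervalIntegral.integral_eq_sub_of_hasDerivAt (a := -C.left) (b := X)
      (f := fun x : ℝ => -Q (x + c)) (f' := fun x : ℝ => f (x + c)) (fun x hx => ?_) ?_
    · rw [this]; ring
    · rw [Set.uIcc_of_le hX] at hx
      have h := (HasDerivAt.comp_add_const (x : ℂ) c (hQ _ (hc x hx.1))).comp_ofReal.neg
      rw [neg_neg] at h
      exact h
    · exact (intervalIntegrable_iff_integrableOn_Ioc_of_le hX).2
        (hi.mono_set Set.Ioc_subset_Ioi_self)
  have hvert : I * (∫ y in (-C.down)..C.up, f (-C.left + y * I)) =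
      Q (-C.left - C.down * I) - Q (-C.left + C.up * I) := by
    have := intervalIntegral.integral_eq_sub_of_hasDerivAt (a := -C.down) (b := C.up)
      (f := fun y : ℝ => I * Q (-C.left + y * I)) (f' := fun y : ℝ => f (-C.left + y * I))
      (fun y hy => ?_) hf₂
    · rw [this]
      push_cast
      rw [neg_mul, ← sub_eq_add_neg]
      linear_combination (Q (-C.left + C.up * I) - Q (-C.left - C.down * I)) * I_mul_I
    · rw [Set.uIcc_of_le hdu] at hy
      have h1 : HasDerivAt (fun w : ℂ => -(C.left : ℂ) + w * I) I (y : ℂ) := by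
        simpa using ((hasDerivAt_id (y : ℂ)).mul_const I).const_add (-(C.left : ℂ))
      have h2 := (((hQ (-C.left + y * I) (Or.inr ⟨by simp, by simpa using hy.1,
        by simpa using hy.2⟩)).comp (y : ℂ) h1).const_mul I).comp_ofReal
      convert! h2 using 1
      linear_combination f (-C.left + y * I) * I_mul_I
  have h₁ := intervalIntegral_tendsto_integral_Ioi (-C.left) hf₁ tendsto_id
  have h₃ := intervalIntegral_tendsto_integral_Ioi (-C.left) hf₃ tendsto_id
  refine ((h₁.neg.sub_const (I * ∫ y in (-C.down)..C.up, f (-C.left + y * I))).add h₃).congr' ?_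
  filter_upwards [eventually_ge_atTop (-C.left)] with X hX
  have e₁ := hline (C.up * I) hf₁ (fun x hx => Or.inl ⟨by simpa using hx, by simp⟩) X hX
  have e₃ := hline (-(C.down * I)) (by simpa only [sub_eq_add_neg] using hf₃)
    (fun x hx => Or.inl ⟨by simpa using hx, by simp⟩) X hX
  simp only [← sub_eq_add_neg] at e₃
  simp only [id]
  rw [e₁, e₃, hvert]
  push_cast
  ring

theorem tendsto_arg_ofReal_add (c : ℂ) :
    Tendsto (fun X : ℝ => arg (X + c)) atTop (nhds 0) := by
  have h1 : Tendsto (fun X : ℝ => 1 + ((X⁻¹ : ℝ) : ℂ) * c) atTop (nhds 1) := by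
    have h0 : Tendsto (fun X : ℝ => ((X⁻¹ : ℝ) : ℂ)) atTop (nhds ((0 : ℝ) : ℂ)) :=
      (continuous_ofReal.tendsto 0).comp tendsto_inv_atTop_zero
    simpa using (h0.mul_const c).const_add 1
  have h2 := (continuousAt_arg one_mem_slitPlane).tendsto.comp h1
  rw [arg_one] at h2
  refine h2.congr' ?_
  filter_upwards [eventually_gt_atTop 0] with X hX
  have : (X : ℂ) + c = (X : ℂ) * (1 + ((X⁻¹ : ℝ) : ℂ) * c) := by
    have : (X : ℂ) ≠ 0 := ofReal_ne_zero.2 hX.ne'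
    push_cast
    field_simp
  rw [Function.comp_apply, this, arg_real_mul _ hX]

theorem re_mul_exp_eq (s v : ℂ) :
    (s * exp v).re = ‖s‖ * Real.exp v.re * Real.cos (arg s + v.im) := by
  conv_lhs => rw [← norm_mul_exp_arg_mul_I s]
  rw [mul_assoc, re_ofReal_mul, ← exp_add, exp_re]
  simp [mul_assoc]

/-- The kernel tends to zero to the right, in the sectors where `-s exp v` is close to the
positive axis. -/
theorem eventually_norm_saddleKernel_le (a : ℂ) {s : ℂ} (hs : 0 < s.re) {M : ℝ} (hM : 0 < M)
    {e : ℝ} (he : e = Real.pi ∨ e = -Real.pi) {ε : ℝ} (hε : 0 < ε) :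
    ∀ᶠ x : ℝ in atTop, ∀ v : ℂ, v.re = x → |v.im - e + arg s| ≤ |arg s| →
      ‖saddleKernel a (-s) M v‖ ≤ ε := by
  have hpi := Real.pi_pos
  have hα := abs_arg_lt_pi_div_two_iff.2 (Or.inl hs)
  set α := arg s with hαdef
  have hlim : Tendsto (fun x : ℝ => Real.exp (M * Real.log 2 + |a.im| * (2 * Real.pi)) *
      (Real.exp x ^ (a.re + 1) / Real.exp (s.re * Real.exp x))) atTop (nhds 0) := by
    have := (isLittleO_rpow_exp_pos_mul_atTop (a.re + 1) hs).tendsto_div_nhds_zero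
    simpa using (this.comp Real.tendsto_exp_atTop).const_mul
      (Real.exp (M * Real.log 2 + |a.im| * (2 * Real.pi)))
  have hsmall : Tendsto (fun x : ℝ => ‖s‖ / M * Real.exp (-x)) atTop (nhds 0) := by
    simpa using (Real.tendsto_exp_atBot.comp tendsto_neg_atTop_atBot).const_mul (‖s‖ / M)
  filter_upwards [hlim.eventually_le_const hε,
    hsmall.eventually_le_const (show (0 : ℝ) < 1 / 2 by norm_num)] with x hx hx' v hv hvim
  refine le_trans ?_ hx
  rw [norm_saddleKernel, ← Real.exp_mul, ← Real.exp_sub, ← Real.exp_add]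
  refine Real.exp_le_exp.2 ?_
  have hb := abs_le.1 hvim
  have hvb : |v.im| ≤ 2 * Real.pi := by
    have h1 := abs_le.1 hα.le
    rcases he with rfl | rfl <;> rw [abs_le] <;> constructor <;> linarith [hb.1, hb.2]
  have h1 : ((a + 1) * v).re ≤ (a.re + 1) * x + |a.im| * (2 * Real.pi) := by
    have : -(a.im * v.im) ≤ |a.im| * (2 * Real.pi) := by
      refine (neg_le_abs _).trans ?_
      rw [abs_mul]
      gcongr
    simp only [mul_re, add_re, one_re, add_im, one_im, add_zero]
    rw [hv]; linarith
  -- In this sector `cos (α + Im v) ≤ -cos α`, which makes `exp(s e^v)` doubly exponentially small.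
  have h2 : s.re * Real.exp x ≤ (-s * exp v).re := by
    rw [neg_mul, neg_re, re_mul_exp_eq, hv]
    have hcos : Real.cos (α + v.im) = -Real.cos (v.im - e + α) := by
      rcases he with rfl | rfl
      · rw [← Real.cos_add_pi]; congr 1; ring
      · rw [← Real.cos_sub_pi]; congr 1; ring
    have hle : Real.cos α ≤ Real.cos (v.im - e + α) := by
      rw [← Real.cos_abs α, ← Real.cos_abs (v.im - e + α)]
      exact Real.cos_le_cos_of_nonneg_of_le_pi (abs_nonneg _) (by linarith) hvim
    have hsre : s.re = ‖s‖ * Real.cos α := (norm_mul_cos_arg s).symm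
    rw [hcos, hsre]
    have h0 : 0 ≤ ‖s‖ * Real.exp x := by positivity
    nlinarith
  have h3 : -Real.log 2 ≤ Real.log ‖1 + -s / M * exp (-v)‖ := by
    rw [← Real.log_inv]
    refine Real.log_le_log (by norm_num) ?_
    have hn : ‖-s / M * exp (-v)‖ ≤ 1 / 2 := by
      rw [norm_mul, norm_div, norm_neg, norm_real, Real.norm_of_nonneg hM.le, norm_exp, neg_re, hv]
      exact hx'
    have := norm_sub_norm_le (1 : ℂ) (-(-s / M * exp (-v)))
    rw [norm_one, norm_neg, sub_neg_eq_add] at this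
    linarith
  have h4 := mul_le_mul_of_nonneg_left h3 hM.le
  linarith

/-- On `Im v = ±π` one has `e^v = -e^x`: the argument of the logarithm has modulus at least `1`, and
the exponential factor has modulus `exp(-Re s · e^x)`. -/
theorem norm_saddleKernel_add_pi_le (a : ℂ) {s : ℂ} {M : ℝ} (hM : 0 < M)
    (hs : |a.re + 1| + 1 ≤ s.re) {e : ℝ} (he : e = Real.pi ∨ e = -Real.pi) {x : ℝ} (hx : 0 ≤ x) :
    ‖saddleKernel a (-s) M (x + e * I)‖ ≤
      Real.exp (Real.pi * |a.im|) * Real.exp (-s.re) * Real.exp (-x) := by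
  have hs0 : 0 < s.re := by linarith [abs_nonneg (a.re + 1)]
  have hexp : exp (x + e * I) = -(Real.exp x : ℂ) := by
    rw [exp_add, ofReal_exp]
    rcases he with rfl | rfl
    · rw [exp_pi_mul_I]; ring
    · rw [ofReal_neg, neg_mul, exp_neg, exp_pi_mul_I]; norm_num
  have hexp' : exp (-(x + e * I)) = -(Real.exp (-x) : ℂ) := by
    rw [exp_neg, hexp, Real.exp_neg]; push_cast; rw [inv_neg]
  rw [norm_saddleKernel, hexp, hexp', ← Real.exp_add, ← Real.exp_add]
  refine Real.exp_le_exp.2 ?_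
  have h1 : ((a + 1) * (x + e * I)).re ≤ |a.re + 1| * x + Real.pi * |a.im| := by
    have h2 : -(a.im * e) ≤ Real.pi * |a.im| := by
      refine (neg_le_abs _).trans (le_of_eq ?_)
      rw [abs_mul, mul_comm]
      congr 1
      rcases he with rfl | rfl <;> simp [Real.pi_pos.le, abs_of_nonneg]
    have h3 : (a.re + 1) * x ≤ |a.re + 1| * x := by gcongr; exact le_abs_self _
    simp
    linarith
  have h4 : (-s * -(Real.exp x : ℂ)).re = s.re * Real.exp x := by
    rw [neg_mul_neg, re_mul_ofReal]
  have h5 : 0 ≤ M * Real.log ‖1 + -s / M * -(Real.exp (-x) : ℂ)‖ := by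
    refine mul_nonneg hM.le (Real.log_nonneg ?_)
    refine le_trans ?_ (re_le_norm _)
    have : -s / M * -(Real.exp (-x) : ℂ) = s / M * (Real.exp (-x) : ℂ) := by ring
    rw [this, add_re, one_re, re_mul_ofReal, div_ofReal_re]
    have : 0 ≤ s.re / M * Real.exp (-x) := by positivity
    linarith
  have h6 : s.re * (x + 1) ≤ s.re * Real.exp x := by
    gcongr; exact Real.add_one_le_exp x
  have h7 : (|a.re + 1| + 1) * x ≤ s.re * x := by gcongr
  rw [h4]
  linarith

theorem differentiableAt_saddleKernel {a σ : ℂ} {M : ℝ} {v : ℂ}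
    (hv : ‖σ / M * exp (-v)‖ < 1) : DifferentiableAt ℂ (saddleKernel a σ M) v := by
  unfold saddleKernel
  exact DifferentiableAt.cexp (DifferentiableAt.sub (by fun_prop)
    ((differentiableAt_const _).mul (DifferentiableAt.clog (by fun_prop)
      (mem_slitPlane_of_norm_lt_one hv))))

/-- On the half-plane where the logarithm is given by its Taylor series, the kernel has a
primitive. -/
theorem exists_hasDerivAt_saddleKernel (a : ℂ) {σ : ℂ} (hσ : σ ≠ 0) {M : ℝ} (hM : 0 < M) :
    ∃ P : ℂ → ℂ, ∀ v : ℂ, Real.log (‖σ‖ / M) < v.re →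
      HasDerivAt P (saddleKernel a σ M v) v ∧ ContinuousAt (saddleKernel a σ M) v := by
  set H : Set ℂ := {v | Real.log (‖σ‖ / M) < v.re} with hH
  have hd : ∀ v ∈ H, DifferentiableAt ℂ (saddleKernel a σ M) v := fun v hv => by
    refine differentiableAt_saddleKernel ?_
    have h0 : 0 < ‖σ‖ / M := div_pos (norm_pos_iff.2 hσ) hM
    have h1 : ‖σ‖ / M < Real.exp v.re := (Real.log_lt_iff_lt_exp h0).1 hv
    rw [norm_mul, norm_div, norm_real, Real.norm_of_nonneg hM.le, norm_exp, neg_re, Real.exp_neg,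
      ← div_eq_mul_inv, div_lt_one (Real.exp_pos _)]
    exact h1
  obtain ⟨P, hP⟩ := (convex_halfSpace_re_gt (Real.log (‖σ‖ / M))).exists_forall_hasDerivWithinAt
    (f := saddleKernel a σ M) fun v hv => (hd v hv).differentiableWithinAt
  exact ⟨P, fun v hv => ⟨(hP v hv).hasDerivAt ((isOpen_lt continuous_const continuous_re).mem_nhds
    hv), (hd v hv).continuousAt⟩⟩

theorem log_sub_log_eq (t s : ℂ) :
    log t - log s = ((Real.log ‖t‖ - Real.log ‖s‖ : ℝ) : ℂ) + ((arg t - arg s : ℝ) : ℂ) * I := by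
  rw [log, log]; push_cast; ring

/-- In the variable `v` the loop comes in at height tending to `-π - arg s` and goes out at height
tending to `π - arg s`. Values of one primitive `P` are compared: each far end is moved to height
`±π` (cost `T/2`), then back to `±πi` along a horizontal line (cost `T`). Both ends together cost
`3T`. -/
theorem HankelLoop.IsOuter.norm_integral_sub_le {C : HankelLoop} {z a : ℂ} (hz : 0 < z.im)
    (hC : C.IsOuter z) (hleft : ‖z‖ < C.left) (hup : ‖z‖ < C.up) (hdown : C.down = C.up)
    {M : ℝ} (hM : 0 < M) {s : ℂ} (hsM : ‖s‖ < M) (hsa : |a.re + 1| + 1 ≤ s.re)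
    (hs : s ^ 2 = -z * M) :
    ‖I * C.integral (loopIntegrand z a M) / s ^ (a + 1) -
        ∫ φ in (-Real.pi)..Real.pi, saddleKernel a (-s) M (φ * I)‖ ≤
      3 * (Real.exp (Real.pi * |a.im|) * Real.exp (-s.re)) := by
  have hpi := Real.pi_pos
  have hs0 : 0 < s.re := by linarith [abs_nonneg (a.re + 1)]
  have hsne : s ≠ 0 := fun h => by simp [h] at hs0
  have hsn : 0 < ‖s‖ := norm_pos_iff.2 hsne
  have hsp : s ^ (a + 1) ≠ 0 := by rw [cpow_def_of_ne_zero hsne]; exact exp_ne_zero _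
  set T := Real.exp (Real.pi * |a.im|) * Real.exp (-s.re) with hT
  have hT0 : 0 < T := by positivity
  have hα := abs_arg_lt_pi_div_two_iff.2 (Or.inl hs0)
  set α := arg s with hαdef
  -- `s` is not real because `Im s² = -M Im z ≠ 0`. Hence `|arg (X + c)| ≤ |α|` for large `X`, and
  -- the heights in question stay in the sector of decay.
  have hα0 : 0 < |α| := by
    refine abs_pos.2 fun h => ?_
    obtain ⟨-, h2⟩ := arg_eq_zero_iff.1 h
    have h3 := congrArg Complex.im hs
    rw [im_mul_ofReal, sq, mul_im, h2] at h3
    simp only [mul_zero, zero_mul, add_zero, neg_im] at h3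
    nlinarith
  set K := saddleKernel a (-s) M with hK
  obtain ⟨P, hP⟩ := exists_hasDerivAt_saddleKernel a (neg_ne_zero.2 hsne) hM
  rw [norm_neg] at hP
  have hH0 : Real.log (‖s‖ / M) < 0 := Real.log_neg (by positivity) ((div_lt_one hM).2 hsM)
  -- a primitive of the integrand in the variable `t`
  have hQ : ∀ t ∈ C.carrier, HasDerivAt (fun t => s ^ (a + 1) * P (log (-t) - log s))
      (-loopIntegrand z a M t) t := fun t ht => by
    have hCu : z.im < C.up := hC.2
    have hdp := C.down_pos
    have hnt : ‖z‖ < ‖t‖ := by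
      rcases ht with ⟨_, h | h⟩ | ⟨h, _⟩
      · refine hup.trans_le ?_
        rw [← h]; exact (le_abs_self _).trans (abs_im_le_norm t)
      · refine hup.trans_le ?_
        rw [← hdown, ← neg_neg C.down, ← h]; exact (neg_le_abs _).trans (abs_im_le_norm t)
      · refine hleft.trans_le ?_
        rw [← neg_neg C.left, ← h]; exact (neg_le_abs _).trans (abs_re_le_norm t)
    have ht0 : t ≠ 0 := norm_pos_iff.1 ((norm_nonneg z).trans_lt hnt)
    have hlog : log (z - t) = log (-t) + log (1 + -z / t) := by
      refine log_sub_eq_log_neg_add hnt ?_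
      rcases ht with ⟨_, h | h⟩ | ⟨h, _⟩
      · right; left; rw [h]; exact ⟨C.up_pos, hCu⟩
      · right; right; rw [h]; constructor <;> linarith
      · left; rw [h]; linarith [C.left_pos]
    have hzt : z - t ≠ 0 := fun h => hnt.ne (by rw [sub_eq_zero.1 h])
    have hker := cpow_mul_saddleKernel_log (a := a) hM.ne' hs hsne ht0 hlog hzt
    have hre : Real.log (‖s‖ / M) < (log (-t) - log s).re := by
      rw [sub_re, log_re, log_re, norm_neg,
        ← Real.log_div (norm_pos_iff.2 ht0).ne' hsn.ne']
      refine Real.log_lt_log (by positivity) ?_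
      have : ‖s‖ ^ 2 = ‖z‖ * M := by
        rw [← norm_pow, hs, norm_mul, norm_neg, norm_real, Real.norm_of_nonneg hM.le]
      rw [div_lt_div_iff₀ hM hsn, ← sq, this]
      gcongr
    have h1 : HasDerivAt (fun t => log (-t) - log s) (-1 / -t) t :=
      ((hasDerivAt_neg t).clog (C.neg_mem_slitPlane ht)).sub_const _
    have h2 := ((hP _ hre).1.comp t h1).const_mul (s ^ (a + 1))
    convert! h2 using 1
    rw [← mul_assoc, hker]
    field_simp
  have hlim := C.tendsto_sub_of_hasDerivAt
    (C.converges_loopIntegrand a M fun t ht => hC.sub_mem_slitPlane hz ht) hQ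
  -- comparison with the horizontal lines `Im v = ± π`
  set ℓ : ℝ → ℝ := fun X => Real.log ‖(X : ℂ) + C.up * I‖ - Real.log ‖s‖ with hℓ
  have hℓt : Tendsto ℓ atTop atTop := by
    refine tendsto_atTop_add_const_right _ _ (Real.tendsto_log_atTop.comp ?_)
    exact tendsto_atTop_mono (fun X => by simpa using re_le_norm ((X : ℂ) + C.up * I)) tendsto_id
  have hcmp : ∀ e : ℝ, (e = Real.pi ∨ e = -Real.pi) → ∀ c : ℂ,
      (∀ X : ℝ, ‖(X : ℂ) + c‖ = ‖(X : ℂ) + C.up * I‖) →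
      ∀ᶠ X : ℝ in atTop,
        ‖P (log (X + c) - log s + e * I) - P (ℓ X + e * I)‖ ≤ T / 2 := by
    intro e he c hc
    have harg := (tendsto_arg_ofReal_add c).abs
    rw [abs_zero] at harg
    filter_upwards [hℓt.eventually (eventually_norm_saddleKernel_le a hs0 hM he
      (show 0 < T / (2 * Real.pi) by positivity)), hℓt.eventually (eventually_gt_atTop 0),
      harg.eventually_le_const hα0] with X hX hX0 hXa
    have hV : log (X + c) - log s + e * I =
        (ℓ X : ℂ) + ((arg (X + c) - α + e : ℝ) : ℂ) * I := by
      rw [log_sub_log_eq, hc X]; simp only [hℓ, hαdef]; push_cast; ring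
    have hconv : Convex ℝ ({ℓ X} ×ℂ Set.Icc (e - α - |α|) (e - α + |α|)) :=
      
      ((convex_singleton (ℓ X)).linear_preimage reLm).inter
        ((convex_Icc (e - α - |α|) (e - α + |α|)).linear_preimage imLm)
    have hb := abs_le.1 hXa
    have := hconv.norm_image_sub_le_of_norm_hasDerivWithin_le (f := P) (f' := K)
      (C := T / (2 * Real.pi)) (x := ℓ X + e * I)
      (y := (ℓ X : ℂ) + ((arg (X + c) - α + e : ℝ) : ℂ) * I) (fun v hv => ?_) (fun v hv => ?_) ?_ ?_
    · rw [hV]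
      refine this.trans ?_
      have hdiff : (ℓ X : ℂ) + ((arg (X + c) - α + e : ℝ) : ℂ) * I - (ℓ X + e * I) =
          ((arg (X + c) - α : ℝ) : ℂ) * I := by push_cast; ring
      rw [hdiff, norm_mul, norm_I, mul_one, norm_real, Real.norm_eq_abs]
      have hle : |arg (X + c) - α| ≤ Real.pi := by
        refine (abs_sub _ _).trans ?_
        linarith
      calc T / (2 * Real.pi) * |arg (X + c) - α| ≤ T / (2 * Real.pi) * Real.pi := by gcongr
        _ = T / 2 := by field_simp
    · have : v.re = ℓ X := hv.1
      exact (hP v (by rw [this]; linarith)).1.hasDerivWithinAt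
    · refine hX v hv.1 (abs_le.2 ?_)
      have := hv.2
      constructor <;> linarith [this.1, this.2]
    · simp only [mem_reProdIm]
      have h1 := neg_abs_le α
      have h2 := le_abs_self α
      refine ⟨by simp, ?_, ?_⟩ <;> simp <;> linarith
    · simp only [mem_reProdIm]
      refine ⟨by simp, ?_, ?_⟩ <;> simp <;> linarith [hb.1, hb.2]
  have hhor : ∀ e : ℝ, (e = Real.pi ∨ e = -Real.pi) → ∀ x : ℝ, 0 ≤ x →
      ‖P (x + e * I) - P (e * I)‖ ≤ T := by
    intro e he x hx
    have hder : ∀ y ∈ Set.uIcc 0 x, HasDerivAt (fun y : ℝ => P (y + e * I)) (K (y + e * I)) y ∧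
        ContinuousAt (fun y : ℝ => K (y + e * I)) y := fun y hy => by
      rw [Set.uIcc_of_le hx] at hy
      obtain ⟨h1, h2⟩ := hP (y + e * I) (by simp; linarith [hy.1])
      exact ⟨(HasDerivAt.comp_add_const (y : ℂ) (e * I) h1).comp_ofReal,
        ContinuousAt.comp (f := fun y : ℝ => (y : ℂ) + e * I) h2 (by fun_prop)⟩
    have hftc := intervalIntegral.integral_eq_sub_of_hasDerivAt (fun y hy => (hder y hy).1)
      (ContinuousOn.intervalIntegrable fun y hy => (hder y hy).2.continuousWithinAt)
    simp only [ofReal_zero, zero_add] at hftc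
    rw [← hftc]
    have hmaj : ∫ y in (0 : ℝ)..x, T * Real.exp (-y) ≤ T := by
      rw [intervalIntegral.integral_const_mul,
        intervalIntegral.integral_comp_neg (fun y => Real.exp y), integral_exp, neg_zero,
        Real.exp_zero]
      nlinarith [Real.exp_pos (-x)]
    refine (intervalIntegral.norm_integral_le_of_norm_le hx (Eventually.of_forall fun y hy => ?_)
      (Continuous.intervalIntegrable (by fun_prop) _ _)).trans hmaj
    exact norm_saddleKernel_add_pi_le a hM hsa he hy.1.le
  have hver : P (Real.pi * I) - P (-Real.pi * I) =
      I * ∫ φ in (-Real.pi)..Real.pi, K (φ * I) := by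
    have hder : ∀ y ∈ Set.uIcc (-Real.pi) Real.pi,
        HasDerivAt (fun y : ℝ => P (y * I)) (I * K (y * I)) y ∧
        ContinuousAt (fun y : ℝ => I * K (y * I)) y := fun y _ => by
      obtain ⟨h1, h2⟩ := hP (y * I) (by simpa using hH0)
      refine ⟨?_, continuousAt_const.mul
        (ContinuousAt.comp (f := fun y : ℝ => (y : ℂ) * I) h2 (by fun_prop))⟩
      have h3 : HasDerivAt (fun w : ℂ => w * I) I (y : ℂ) := by
        simpa using (hasDerivAt_id (y : ℂ)).mul_const I
      have := (h1.comp (y : ℂ) h3).comp_ofReal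
      rwa [mul_comm] at this
    have hftc := intervalIntegral.integral_eq_sub_of_hasDerivAt (fun y hy => (hder y hy).1)
      (ContinuousOn.intervalIntegrable fun y hy => (hder y hy).2.continuousWithinAt)
    rw [intervalIntegral.integral_const_mul] at hftc
    rw [hftc]
    push_cast
    rfl
  -- passage to the limit
  have hJ := ((hlim.const_mul I).div_const (s ^ (a + 1))).sub_const
    (∫ φ in (-Real.pi)..Real.pi, K (φ * I))
  refine le_of_tendsto hJ.norm ?_
  have hnorm : ∀ X : ℝ, ‖(X : ℂ) + -(C.up * I)‖ = ‖(X : ℂ) + C.up * I‖ := fun X => by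
    rw [← norm_conj]
    simp
  filter_upwards [hcmp (-Real.pi) (Or.inr rfl) (C.up * I) (fun _ => rfl),
    hcmp Real.pi (Or.inl rfl) (-(C.up * I)) hnorm, hℓt.eventually (eventually_ge_atTop 0)]
    with X h1 h2 h3
  have h4 := hhor (-Real.pi) (Or.inr rfl) (ℓ X) h3
  have h5 := hhor Real.pi (Or.inl rfl) (ℓ X) h3
  have l1 : log (-((X : ℂ) + C.up * I)) = log (X + C.up * I) - Real.pi * I :=
    log_neg_of_im_pos (by simpa using C.up_pos)
  have l2 : log (-((X : ℂ) - C.down * I)) = log (X + -(C.up * I)) + Real.pi * I := by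
    have := log_neg_of_im_pos (u := -((X : ℂ) - C.down * I)) (by simpa using C.down_pos)
    rw [neg_neg] at this
    rw [← sub_eq_add_neg, ← hdown, this]; ring
  set p₁ := P (log (X + C.up * I) - log s + (-Real.pi : ℝ) * I)
  set p₂ := P (log (X + -(C.up * I)) - log s + (Real.pi : ℝ) * I)
  have e1 : P (log (-((X : ℂ) + C.up * I)) - log s) = p₁ := by
    rw [l1]; congr 1; push_cast; ring
  have e2 : P (log (-((X : ℂ) - C.down * I)) - log s) = p₂ := by
    rw [l2]; congr 1; ring
  simp only [e1, e2]
  have hfin : I * (s ^ (a + 1) * p₁ - s ^ (a + 1) * p₂) / s ^ (a + 1) -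
      ∫ φ in (-Real.pi)..Real.pi, K (φ * I) =
      I * ((p₁ - P (ℓ X + (-Real.pi : ℝ) * I)) - (p₂ - P (ℓ X + Real.pi * I)) +
        (P (ℓ X + (-Real.pi : ℝ) * I) - P ((-Real.pi : ℝ) * I)) -
        (P (ℓ X + Real.pi * I) - P (Real.pi * I))) := by
    rw [← mul_sub, mul_left_comm, mul_div_cancel_left₀ _ hsp]
    push_cast
    linear_combination -I * hver - (∫ φ in (-Real.pi)..Real.pi, K (φ * I)) * I_mul_I
  rw [hfin, norm_mul, norm_I, one_mul]
  refine (norm_sub_le _ _).trans ?_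
  refine (add_le_add (norm_add_le _ _) le_rfl).trans ?_
  have := norm_sub_le (p₁ - P (ℓ X + (-Real.pi : ℝ) * I)) (p₂ - P (ℓ X + Real.pi * I))
  linarith

/-! ### The saddle integral along the imaginary axis. -/

/-- Asymptotics of the saddle point integral along a segment of the imaginary axis. -/
theorem exists_norm_integral_saddleKernel_mul_I_sub_le (a : ℂ) {k : ℂ} (hk : 0 < k.re) :
    ∃ C N, 0 < N ∧ ∀ M : ℝ, N ≤ M → ∀ s : ℂ, s = √M * k →
      ‖exp (2 * -s - k ^ 2 / 2) * (∫ φ in (-Real.pi)..Real.pi, saddleKernel a (-s) M (φ * I)) -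
        (Real.pi / s) ^ (1 / 2 : ℂ)‖ ≤ C * (‖s‖⁻¹ * (√‖s‖)⁻¹) := by
  have hk0 : k ≠ 0 := fun h => by simp [h] at hk
  have hkn : 0 < ‖k‖ := norm_pos_iff.2 hk0
  have hpi := Real.pi_pos
  set c₀ := k.re / ‖k‖ with hc₀
  have hc₀p : 0 < c₀ := by positivity
  obtain ⟨C₁, N₁, hC₁, hN₁, H₁⟩ :=
    exists_norm_saddleKernel_sub_le a (pow_ne_zero 2 hk0) (c₀ / 4) Real.pi
  obtain ⟨C', HL⟩ := exists_norm_integral_sub_gaussian_le (κ := c₀ / 4) (R := Real.pi) (C := C₁)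
    ((a + 1 - k ^ 2) * I) (by positivity) hpi hC₁
  refine ⟨C', max N₁ (max ((1 / ‖k‖) ^ 2) (‖k‖ ^ 2 + 1)), lt_max_of_lt_left hN₁,
    fun M hM s hs => ?_⟩
  have hM₁ : N₁ ≤ M := (le_max_left _ _).trans hM
  have hM' := (le_max_right _ _).trans hM
  have hM₂ := (le_max_left _ _).trans hM'
  have hM₃ := (le_max_right _ _).trans hM'
  have hM0 : 0 < M := by linarith
  have hr0 : 0 < √M := Real.sqrt_pos.2 hM0
  have hsn : ‖s‖ = √M * ‖k‖ := by rw [hs, norm_mul, norm_real, Real.norm_of_nonneg hr0.le]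
  have hsre : s.re = √M * k.re := by rw [hs, re_ofReal_mul]
  have hsc : s.re = c₀ * ‖s‖ := by rw [hsre, hsn, hc₀]; field_simp
  have hs0 : 0 < s.re := by rw [hsre]; positivity
  have hs2 : (-s) ^ 2 = k ^ 2 * M := by
    rw [neg_sq, hs, mul_pow, ← ofReal_pow, Real.sq_sqrt hM0.le]; ring
  have hs1 : 1 ≤ ‖s‖ := by
    have := Real.le_sqrt_of_sq_le hM₂
    rw [div_le_iff₀ hkn] at this
    rwa [hsn]
  -- This keeps the argument of the logarithm off the cut when `Re v = 0`.
  have hsM : ‖s‖ / M < 1 := by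
    rw [div_lt_one hM0, hsn]
    have : ‖k‖ < √M := Real.lt_sqrt_of_sq_lt (by linarith)
    calc √M * ‖k‖ < √M * √M := by gcongr
      _ = M := Real.mul_self_sqrt hM0.le
  have hcont : Continuous fun φ : ℝ => saddleKernel a (-s) M (φ * I) := by
    refine continuous_iff_continuousAt.2 fun φ => ContinuousAt.comp
      (f := fun φ : ℝ => (φ : ℂ) * I) (differentiableAt_saddleKernel ?_).continuousAt (by fun_prop)
    rw [norm_mul, norm_div, norm_neg, norm_real, Real.norm_of_nonneg hM0.le, norm_exp]
    simpa using hsM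
  -- With extension by zero and `R = π`, the tail condition of Laplace's method is trivial.
  set F : ℝ → ℂ := (Set.Icc (-Real.pi) Real.pi).indicator
    fun φ => exp (2 * -s - k ^ 2 / 2) * saddleKernel a (-s) M (φ * I) with hF
  have hFint : ∫ φ, F φ = exp (2 * -s - k ^ 2 / 2) *
      ∫ φ in (-Real.pi)..Real.pi, saddleKernel a (-s) M (φ * I) := by
    rw [hF, integral_indicator measurableSet_Icc, integral_Icc_eq_integral_Ioc,
      ← intervalIntegral.integral_of_le (by linarith), intervalIntegral.integral_const_mul]
  rw [← hFint]
  refine HL s hs1 (by rw [hsc]; nlinarith [norm_nonneg s]) F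
    ((hcont.const_mul _).aestronglyMeasurable.indicator measurableSet_Icc)
    (fun x hx => ?_) fun x hx => ?_
  · have hxI : ‖(x : ℂ) * I‖ = |x| := by simp
    have hmem : x ∈ Set.Icc (-Real.pi) Real.pi := abs_le.1 hx
    have h0 : 0 ≤ c₀ * ‖s‖ * x ^ 2 := by positivity
    have := H₁ M (-s) hM₁ hs2 (x * I) (by rwa [hxI]) ?_ ?_
    · rw [hF, Set.indicator_of_mem hmem]
      rw [hxI, norm_neg, sq_abs, show |x| ^ 4 = x ^ 4 from (even_two_mul 2).pow_abs x] at this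
      convert! this using 3
      rw [mul_pow, I_sq]
      ring_nf
    · rw [hxI, norm_neg, sq_abs]
      have e : (2 * -s * (cosh (x * I) - 1)).re = s.re * (2 * (1 - Real.cos x)) := by
        rw [cosh_mul_I, ← ofReal_cos]
        have : 2 * -s * ((Real.cos x : ℂ) - 1) = s * ((2 * (1 - Real.cos x) : ℝ) : ℂ) := by
          push_cast; ring
        rw [this, re_mul_ofReal]
      -- `1 - cos x ≥ 2x²/π² ≥ x²/8` on `[-π, π]`, since `π ≤ 4`; this is where `κ = c₀/4` comes
      -- from.
      have hcos := Real.cos_le_one_sub_mul_cos_sq hx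
      have hq : 1 / 8 * x ^ 2 ≤ 2 / Real.pi ^ 2 * x ^ 2 := by
        refine mul_le_mul_of_nonneg_right ?_ (sq_nonneg x)
        rw [div_le_div_iff₀ (by norm_num) (by positivity)]
        nlinarith [Real.pi_le_four]
      rw [e, hsc]
      have : c₀ * ‖s‖ * (1 / 4 * x ^ 2) ≤ c₀ * ‖s‖ * (2 * (1 - Real.cos x)) :=
        mul_le_mul_of_nonneg_left (by linarith) (by positivity)
      linarith
    · rw [hxI, norm_neg, sq_abs]
      have e : (-s * (x * I) ^ 2).re = s.re * x ^ 2 := by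
        rw [mul_pow, I_sq, mul_neg_one, neg_mul_neg, ← ofReal_pow, re_mul_ofReal]
      rw [e, hsc]
      linarith
  · rw [hF, Set.indicator_of_notMem (s := Set.Icc (-Real.pi) Real.pi) fun h => hx.not_ge (abs_le.2 (Set.mem_Icc.1 h)), norm_zero]
    positivity

theorem HankelLoop.IsOuter.exists_norm_integral_sub_le {C : HankelLoop} {z : ℂ} (a : ℂ)
    (hz : 0 < z.im) (hC : C.IsOuter z) {k : ℂ} (hk : 0 < k.re) (hkz : k ^ 2 = -z) :
    ∃ B N, 0 < N ∧ ∀ M : ℝ, N ≤ M → ∀ s : ℂ, s = √M * k →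
      ‖exp (2 * -s - k ^ 2 / 2) * (I * C.integral (loopIntegrand z a M) / s ^ (a + 1)) -
        (Real.pi / s) ^ (1 / 2 : ℂ)‖ ≤ B * (‖s‖⁻¹ * (√‖s‖)⁻¹) := by
  obtain ⟨B, N, hN, H⟩ := exists_norm_integral_saddleKernel_mul_I_sub_le a hk
  have hk0 : k ≠ 0 := fun h => by simp [h] at hk
  have hkn : 0 < ‖k‖ := norm_pos_iff.2 hk0
  have hzn := norm_nonneg z
  -- An enlarged loop with `up = down`, on which `‖z‖ < ‖t‖`.
  set D : HankelLoop := ⟨C.left + ‖z‖, C.up + C.down + ‖z‖, C.up + C.down + ‖z‖,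
    by linarith [C.left_pos], by linarith [C.up_pos, C.down_pos],
    by linarith [C.up_pos, C.down_pos]⟩ with hD
  have hDo : D.IsOuter z := ⟨by simp only [hD]; linarith [hC.1],
    by simp only [hD]; linarith [hC.2, C.down_pos]⟩
  set c₀ := k.re / ‖k‖ with hc₀
  have hc₀p : 0 < c₀ := by positivity
  set A := Real.exp (‖k‖ ^ 2 / 2) * (3 * Real.exp (Real.pi * |a.im|)) with hA
  refine ⟨B + A * (24 / c₀ ^ 4), max N (max ((1 / ‖k‖) ^ 2) (max (‖k‖ ^ 2 + 1)
    (((|a.re + 1| + 1) / k.re) ^ 2))), lt_max_of_lt_left hN, fun M hM s hs => ?_⟩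
  have hM₁ : N ≤ M := (le_max_left _ _).trans hM
  have hM' := (le_max_right _ _).trans hM
  have hM₂ := (le_max_left _ _).trans hM'
  have hM'' := (le_max_right _ _).trans hM'
  have hM₃ := (le_max_left _ _).trans hM''
  have hM₄ := (le_max_right _ _).trans hM''
  have hM0 : 0 < M := by linarith
  have hr0 : 0 < √M := Real.sqrt_pos.2 hM0
  have hsn : ‖s‖ = √M * ‖k‖ := by rw [hs, norm_mul, norm_real, Real.norm_of_nonneg hr0.le]
  have hsre : s.re = √M * k.re := by rw [hs, re_ofReal_mul]
  have hsc : s.re = c₀ * ‖s‖ := by rw [hsre, hsn, hc₀]; field_simp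
  have hs0 : 0 < s.re := by rw [hsre]; positivity
  have hs2 : s ^ 2 = -z * M := by
    rw [hs, mul_pow, ← ofReal_pow, Real.sq_sqrt hM0.le, hkz]; ring
  have hs1 : 1 ≤ ‖s‖ := by
    have := Real.le_sqrt_of_sq_le hM₂
    rw [div_le_iff₀ hkn] at this
    rwa [hsn]
  have hsM : ‖s‖ < M := by
    rw [hsn]
    have : ‖k‖ < √M := Real.lt_sqrt_of_sq_lt (by linarith)
    calc √M * ‖k‖ < √M * √M := by gcongr
      _ = M := Real.mul_self_sqrt hM0.le
  have hsa : |a.re + 1| + 1 ≤ s.re := by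
    have := Real.le_sqrt_of_sq_le hM₄
    rw [div_le_iff₀ hk] at this
    rwa [hsre]
  have h₁ := H M hM₁ s hs
  have h₂ := hDo.norm_integral_sub_le (a := a) hz (by simp only [hD]; linarith [C.left_pos])
    (by simp only [hD]; linarith [C.up_pos, C.down_pos]) rfl hM0 hsM hsa hs2
  rw [hC.integral_eq_of_le (D := D) hz (by simp only [hD]; linarith)
    (by simp only [hD]; linarith [C.down_pos]) (by simp only [hD]; linarith [C.up_pos])]
  set J := I * D.integral (loopIntegrand z a M) / s ^ (a + 1)
  set J' := ∫ φ in (-Real.pi)..Real.pi, saddleKernel a (-s) M (φ * I)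
  have hE : ‖exp (2 * -s - k ^ 2 / 2)‖ ≤ Real.exp (‖k‖ ^ 2 / 2) := by
    rw [norm_exp]
    refine Real.exp_le_exp.2 ?_
    have h1 : -(k ^ 2 / 2).re ≤ ‖k‖ ^ 2 / 2 := by
      refine (neg_le_abs _).trans ((abs_re_le_norm _).trans ?_)
      simp
    have h2 : (2 * -s).re = -2 * s.re := by simp
    rw [sub_re, h2]
    linarith
  have hexp : Real.exp (-s.re) ≤ 24 / c₀ ^ 4 * (‖s‖⁻¹ * (√‖s‖)⁻¹) := by
    have hn0 : 0 < ‖s‖ := by linarith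
    have hq : ‖s‖⁻¹ ^ 3 ≤ (√‖s‖)⁻¹ := by
      calc ‖s‖⁻¹ ^ 3 ≤ ‖s‖⁻¹ ^ 1 :=
            pow_le_pow_of_le_one (by positivity) (inv_le_one_of_one_le₀ hs1) (by norm_num)
        _ = ‖s‖⁻¹ := pow_one _
        _ ≤ (√‖s‖)⁻¹ := by
            refine inv_anti₀ (by positivity) ?_
            rw [Real.sqrt_le_left hn0.le]
            nlinarith
    calc Real.exp (-s.re) ≤ 24 / s.re ^ 4 := exp_neg_le_div_pow_four hs0
      _ = 24 / c₀ ^ 4 * (‖s‖⁻¹ * ‖s‖⁻¹ ^ 3) := by rw [hsc]; field_simp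
      _ ≤ _ := by gcongr
  have e : exp (2 * -s - k ^ 2 / 2) * J - (Real.pi / s) ^ (1 / 2 : ℂ) =
      (exp (2 * -s - k ^ 2 / 2) * J' - (Real.pi / s) ^ (1 / 2 : ℂ)) +
        exp (2 * -s - k ^ 2 / 2) * (J - J') := by ring
  rw [e, add_mul]
  refine (norm_add_le _ _).trans (add_le_add h₁ ?_)
  rw [norm_mul]
  calc _ ≤ Real.exp (‖k‖ ^ 2 / 2) *
        (3 * (Real.exp (Real.pi * |a.im|) * (24 / c₀ ^ 4 * (‖s‖⁻¹ * (√‖s‖)⁻¹)))) := by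
        gcongr
        exact h₂.trans (by gcongr)
    _ = _ := by rw [hA]; ring

/-! ### Branches of the powers, relative errors and conclusion. -/

/-- For `Re s > 0` the principal logarithm satisfies `log s² = 2 log s`, and `a + 1 - 1/2 = 2 · (2a
+ 1)/4`. -/
theorem cpow_mul_pi_div_cpow (a : ℂ) {s : ℂ} (hs : 0 < s.re) :
    s ^ (a + 1) * (Real.pi / s) ^ (1 / 2 : ℂ) =
      (√Real.pi : ℂ) * (s ^ 2) ^ ((2 * a + 1) / 4) := by
  have hs0 : s ≠ 0 := fun h => by simp [h] at hs
  have hpi := Real.pi_pos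
  have harg := abs_lt.1 (abs_arg_lt_pi_div_two_iff.2 (Or.inl hs))
  have h₁ : log (Real.pi / s) = Real.log Real.pi - log s := by
    rw [div_eq_mul_inv, log_ofReal_mul hpi (inv_ne_zero hs0), log_inv _ (by linarith [harg.2]),
      sub_eq_add_neg]
  have h₂ : log (s ^ 2) = 2 * log s := by
    rw [sq, (log_mul_eq_add_log_iff hs0 hs0).2 ⟨by linarith [harg.1], by linarith [harg.2]⟩, two_mul]
  have h₃ : (√Real.pi : ℂ) = exp (Real.log Real.pi / 2) := by
    rw [Real.sqrt_eq_rpow, Real.rpow_def_of_pos hpi, ofReal_exp]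
    push_cast
    congr 1; ring
  rw [cpow_def_of_ne_zero hs0, cpow_def_of_ne_zero (div_ne_zero (ofReal_ne_zero.2 hpi.ne') hs0),
    cpow_def_of_ne_zero (pow_ne_zero 2 hs0), h₁, h₂, h₃, ← exp_add, ← exp_add]
  congr 1; ring

theorem norm_pi_div_cpow {s : ℂ} (hs : s ≠ 0) :
    ‖(Real.pi / s) ^ (1 / 2 : ℂ)‖ = √Real.pi * (√‖s‖)⁻¹ := by
  have hpi := Real.pi_pos
  rw [norm_cpow_of_ne_zero (div_ne_zero (ofReal_ne_zero.2 hpi.ne') hs)]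
  have h : (1 / 2 : ℂ) = ((1 / 2 : ℝ) : ℂ) := by norm_num
  rw [h, ofReal_re, ofReal_im, mul_zero, Real.exp_zero, div_one, ← Real.sqrt_eq_rpow, norm_div,
    norm_real, Real.norm_of_nonneg hpi.le, Real.sqrt_div hpi.le, div_eq_mul_inv]

/-- The relative error of an approximation by `(π / s) ^ (1 / 2)`, where `s = √M k`. -/
theorem exists_eq_mul_one_add {k : ℂ} (hk : 0 < k.re) {E J : ℝ → ℂ} {B N : ℝ} (hN : 0 < N)
    (h : ∀ M : ℝ, N ≤ M → ‖exp (E M) * J M - (Real.pi / (√M * k)) ^ (1 / 2 : ℂ)‖ ≤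
      B * (‖√M * k‖⁻¹ * (√‖√M * k‖)⁻¹)) :
    ∃ r : ℝ → ℂ, r =O[atTop] (fun M : ℝ => M ^ (-(1 / 2) : ℝ)) ∧ ∀ M : ℝ, N ≤ M →
      J M = exp (-E M) * (Real.pi / (√M * k)) ^ (1 / 2 : ℂ) * (1 + r M) := by
  have hk0 : k ≠ 0 := fun h => by simp [h] at hk
  have hpi := Real.pi_pos
  have hs : ∀ M : ℝ, N ≤ M → (√M * k : ℂ) ≠ 0 := fun M hM =>
    mul_ne_zero (ofReal_ne_zero.2 (Real.sqrt_pos.2 (hN.trans_le hM)).ne') hk0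
  have hp : ∀ M : ℝ, N ≤ M → ((Real.pi / (√M * k)) ^ (1 / 2 : ℂ) : ℂ) ≠ 0 := fun M hM => by
    rw [cpow_def_of_ne_zero (div_ne_zero (ofReal_ne_zero.2 hpi.ne') (hs M hM))]
    exact exp_ne_zero _
  refine ⟨fun M => exp (E M) * J M / (Real.pi / (√M * k)) ^ (1 / 2 : ℂ) - 1, ?_, fun M hM => ?_⟩
  · refine IsBigO.of_bound (B * (√Real.pi)⁻¹ * ‖k‖⁻¹) (eventually_atTop.2 ⟨N, fun M hM => ?_⟩)
    have hM0 := hN.trans_le hM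
    have hq := hp M hM
    have e : exp (E M) * J M / (Real.pi / (√M * k)) ^ (1 / 2 : ℂ) - 1 =
        (exp (E M) * J M - (Real.pi / (√M * k)) ^ (1 / 2 : ℂ)) /
          (Real.pi / (√M * k)) ^ (1 / 2 : ℂ) := by rw [sub_div, div_self hq]
    have hsn : 0 < ‖(√M * k : ℂ)‖ := norm_pos_iff.2 (hs M hM)
    have hMr : ‖M ^ (-(1 / 2) : ℝ)‖ = (√M)⁻¹ := by
      rw [Real.norm_of_nonneg (by positivity), Real.rpow_neg hM0.le, Real.sqrt_eq_rpow]
    rw [e, norm_div, norm_pi_div_cpow (hs M hM), hMr]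
    have hsq : 0 < √M := Real.sqrt_pos.2 hM0
    rw [div_le_iff₀ (by positivity)]
    refine (h M hM).trans (le_of_eq ?_)
    have hn : ‖(√M * k : ℂ)‖⁻¹ = (√M)⁻¹ * ‖k‖⁻¹ := by
      rw [norm_mul, norm_real, Real.norm_of_nonneg hsq.le, mul_inv]
    rw [hn]
    have : √Real.pi ≠ 0 := (Real.sqrt_pos.2 hpi).ne'
    field_simp
  · have hq := hp M hM
    rw [add_sub_cancel, mul_assoc, mul_div_cancel₀ _ hq, ← mul_assoc, ← exp_add, neg_add_cancel,
      exp_zero, one_mul]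

theorem sqrt_neg_spec {z : ℂ} (hz : 0 < z.im) :
    ((-z) ^ (1 / 2 : ℂ)) ^ 2 = -z ∧ 0 < ((-z) ^ (1 / 2 : ℂ)).re ∧ ((-z) ^ (1 / 2 : ℂ)).im < 0 := by
  have hz0 : -z ≠ 0 := fun h => by simp [neg_eq_zero.1 h] at hz
  have ha : arg (-z) < 0 := arg_neg_iff.2 (by simpa using hz)
  have ha' := neg_pi_lt_arg (-z)
  have him : (log (-z) * (1 / 2)).im = arg (-z) / 2 := by
    have : log (-z) * (1 / 2) = log (-z) * ((1 / 2 : ℝ) : ℂ) := by norm_num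
    rw [this, im_mul_ofReal, log_im]; ring
  rw [cpow_def_of_ne_zero hz0]
  refine ⟨?_, ?_, ?_⟩
  · rw [← exp_nat_mul]
    conv_rhs => rw [← exp_log hz0]
    congr 1; push_cast; ring
  · rw [exp_re, him]
    exact mul_pos (Real.exp_pos _) (Real.cos_pos_of_mem_Ioo ⟨by linarith, by linarith⟩)
  · rw [exp_im, him]
    exact mul_neg_of_pos_of_neg (Real.exp_pos _)
      (Real.sin_neg_of_neg_of_neg_pi_lt (by linarith) (by linarith))

end

theorem mainTheorem3 (z a : ℂ) (hz : 0 < z.im) :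
    (∀ C : HankelLoop, C.IsOuter z →
      (∀ M : ℝ, C.Converges (loopIntegrand z a M)) ∧
      ∃ r : ℝ → ℂ, r =O[atTop] (fun M : ℝ => M ^ (-(1 / 2) : ℝ)) ∧
        ∀ᶠ M : ℝ in atTop,
          C.integral (loopIntegrand z a M) =
            -I * (Real.sqrt Real.pi : ℂ) * (-(z * M)) ^ ((2 * a + 1) / 4) *
              exp (2 * (-(z * M)) ^ (1 / 2 : ℂ) - z / 2) * (1 + r M)) ∧
    (∀ C : HankelLoop, C.IsInner z →
      (∀ M : ℝ, C.Converges (loopIntegrand z a M)) ∧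
      ∃ r : ℝ → ℂ, r =O[atTop] (fun M : ℝ => M ^ (-(1 / 2) : ℝ)) ∧
        ∀ᶠ M : ℝ in atTop,
          C.integral (loopIntegrand z a M) =
            (Real.sqrt Real.pi : ℂ) * (exp (2 * Real.pi * I * (M + a)) - 1) *
              (-(z * M)) ^ ((2 * a + 1) / 4) *
              exp (-2 * (-(z * M)) ^ (1 / 2 : ℂ) - z / 2 - Real.pi * I * a
                - 2 * Real.pi * I * M) * (1 + r M)) := by
  obtain ⟨hkz, hk, hk'⟩ := sqrt_neg_spec hz
  set k := (-z) ^ (1 / 2 : ℂ)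
  have hsq : ∀ M : ℝ, 0 < M → -(z * M) = (√M * k) ^ 2 := fun M hM => by
    rw [mul_pow, ← ofReal_pow, Real.sq_sqrt hM.le, hkz]; ring
  have hre : ∀ M : ℝ, 0 < M → 0 < (√M * k : ℂ).re := fun M hM => by
    rw [re_ofReal_mul]; exact mul_pos (Real.sqrt_pos.2 hM) hk
  have hroot : ∀ M : ℝ, 0 < M → (-(z * M)) ^ (1 / 2 : ℂ) = √M * k := fun M hM => by
    rw [hsq M hM, one_div]; exact sq_cpow_two_inv (hre M hM)
  refine ⟨fun C hC => ⟨fun M => C.converges_loopIntegrand a M fun t ht =>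
    hC.sub_mem_slitPlane hz ht, ?_⟩, fun C hC => ⟨fun M => C.converges_loopIntegrand a M fun t ht =>
    hC.sub_mem_slitPlane ht, ?_⟩⟩
  · obtain ⟨B, N, hN, H⟩ := hC.exists_norm_integral_sub_le a hz hk hkz
    obtain ⟨r, hr, hrJ⟩ := exists_eq_mul_one_add hk hN (fun M hM => H M hM _ rfl)
    refine ⟨r, hr, eventually_atTop.2 ⟨N, fun M hM => ?_⟩⟩
    have hM0 := hN.trans_le hM
    have hs0 : (√M * k : ℂ) ≠ 0 := fun h => by simpa [h] using hre M hM0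
    have hp : (√M * k : ℂ) ^ (a + 1) ≠ 0 := by
      rw [cpow_def_of_ne_zero hs0]; exact exp_ne_zero _
    have hJ := hrJ M hM
    rw [div_eq_iff hp] at hJ
    have hE : -(2 * -(√M * k : ℂ) - k ^ 2 / 2) = 2 * (√M * k) - z / 2 := by rw [hkz]; ring
    rw [hE] at hJ
    rw [hroot M hM0, hsq M hM0]
    linear_combination -I * hJ + C.integral (loopIntegrand z a M) * I_mul_I -
      I * exp (2 * (√M * k) - z / 2) * (1 + r M) * cpow_mul_pi_div_cpow a (hre M hM0)
  · obtain ⟨B, N, hN, H⟩ := exists_norm_integral_saddleKernel_sub_le a hk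
    have H' : ∀ M : ℝ, N ≤ M → ‖exp (2 * (√M * k) - k ^ 2 / 2) *
        (∫ x : ℝ, saddleKernel a (√M * k) M x) - (Real.pi / (√M * k)) ^ (1 / 2 : ℂ)‖ ≤
        B * (‖√M * k‖⁻¹ * (√‖√M * k‖)⁻¹) := fun M hM => by
      have := H M hM _ rfl
      rwa [integral_const_mul] at this
    obtain ⟨r, hr, hrJ⟩ := exists_eq_mul_one_add hk hN H'
    -- `M ≥ 1 - Re a` gives `Re (M + a) > 0`, so the integrand vanishes at the origin as the
    -- collapse requires.
    refine ⟨r, hr, eventually_atTop.2 ⟨max N (1 - a.re), fun M hM => ?_⟩⟩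
    have hMN := (le_max_left _ _).trans hM
    have hM0 := hN.trans_le hMN
    have hMa : 0 < M + a.re := by linarith [(le_max_right _ _).trans hM]
    have hE : exp (-2 * (√M * k) - z / 2 - Real.pi * I * a - 2 * Real.pi * I * M) =
        exp (-(Real.pi * I * a) - 2 * Real.pi * I * M) *
          exp (-(2 * (√M * k : ℂ) - k ^ 2 / 2)) := by
      rw [← exp_add, hkz]; congr 1; ring
    rw [hC.integral_loopIntegrand_eq_saddle hz hk hk' hkz hM0 hMa rfl, hrJ M hMN, hroot M hM0,
      hE, hsq M hM0]
    linear_combination (exp (2 * Real.pi * I * (M + a)) - 1) *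
      exp (-(Real.pi * I * a) - 2 * Real.pi * I * M) *
      exp (-(2 * (√M * k : ℂ) - k ^ 2 / 2)) * (1 + r M) * cpow_mul_pi_div_cpow a (hre M hM0)
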